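/- Notation. For $y\in\mathbb R^m$ let $\langle y\rangle$ be the unique point of $[-1/2,1/2)^m$ congruent to $y$ modulo $\mathbb Z^m$, let $|\cdot|$ be the supremum norm and $\|y\|=|\langle y\rangle|$. For a real $m\times n$ matrix $X$ and $\theta\in\mathbb R^m$, let $w(X,\theta)\in[0,\infty]$ be the supremum of the $w\ge 0$ such that for arbitrarily large $Q>1$ there is $q\in\mathbb Z^n\setminus\{0\}$ with $$\|Xq+\theta\|^m<Q^{-w}\quad\text{and}\quad |q|^n\le Q,$$ and let $w^{\times}(X,\theta)\in[0,\infty]$ be the supremum of the $w\ge 0$ such that for arbitrarily large $Q>1$ there is $q\in\mathbb Z^n\setminus\{0\}$ with $$\prod_{j=1}^m|\langle Xq+\theta\rangle_j|<Q^{-w}\quad\text{and}\quad \prod_{i=1}^n\max\{1,|q_i|\}\le Q.$$ Let $M$ be a differentiable (i.e. $C^1$, embedded) submanifold of $\mathbb R^n$ of dimension $d\ge 1$; "almost every" refers to its Riemannian measure. Call $M$ (strongly) extremal if $w(X,0)=1$ (respectively $w^\times(X,0)=1$) for almost every $X\in M$, where $\mathbb R^n$ is identified either with the columns $\mathbb R^{n\times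 1}$ or with the rows $\mathbb R^{1\times n}$. Call $M$ simultaneously inhomogeneously (strongly) extremal if, with $\mathbb R^n$ identified with $\mathbb R^{n\times 1}$, for every $\theta\in\mathbb R^n$ one has $w(X,\theta)=1$ (respectively $w^\times(X,\theta)=1$) for almost every $X\in M$. **Theorem.** Each of the following holds for either of the two identifications of $\mathbb R^n$ used in the definition of "(strongly) extremal". (A) $M$ is extremal if and only if $M$ is simultaneously inhomogeneously extremal. (B) Suppose in addition that at almost every point of $M$ the tangent plane is not orthogonal to any of the coordinate axes. Then $M$ is strongly extremal if and only if $M$ is simultaneously inhomogeneously strongly extremal. -/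

import Mathlib

open MeasureTheory Filter Topology
open scoped ENNReal NNReal Matrix

noncomputable section

namespace DiophantineSubmanifold

/-! ### Diophantine exponents of a system of linear forms -/

/-- The unique point `⟨y⟩` of `[-1/2, 1/2)^m` that is congruent to `y` modulo `ℤ^m`.
Its sup norm `‖centered y‖` is the distance from `y` to the nearest integer point. -/
def centered {m : ℕ} (y : Fin m → ℝ) : Fin m → ℝ := fun j => y j - round (y j)

/-- The vector `X q + θ`, for an integer column `q`. -/
def linForms {m n : ℕ} (X : Matrix (Fin m) (Fin n) ℝ) (θ : Fin m → ℝ) (q : Fin n → ℤ) :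
    Fin m → ℝ :=
  X *ᵥ (fun i => (q i : ℝ)) + θ

/-- The exponent `w(X, θ) ∈ [0, ∞]`: the supremum of the `w ≥ 0` such that for arbitrarily large
`Q` there is a nonzero integer vector `q` with `‖X q + θ‖ ^ m < Q ^ (-w)` and `|q| ^ n ≤ Q`
(distance to the nearest integer point and sup norm, respectively). -/
def exponent {m n : ℕ} (X : Matrix (Fin m) (Fin n) ℝ) (θ : Fin m → ℝ) : ℝ≥0∞ :=
  ⨆ (w : ℝ≥0) (_ : ∃ᶠ Q : ℝ in atTop, ∃ q : Fin n → ℤ, q ≠ 0 ∧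
      ‖centered (linForms X θ q)‖ ^ m < Q ^ (-(w : ℝ)) ∧
      ‖fun i => (q i : ℝ)‖ ^ n ≤ Q), (w : ℝ≥0∞)

/-- The multiplicative exponent `w^×(X, θ) ∈ [0, ∞]`: the supremum of the `w ≥ 0` such that for
arbitrarily large `Q` there is a nonzero integer vector `q` with
`∏ j, |⟨X q + θ⟩ j| < Q ^ (-w)` and `∏ i, max 1 |q i| ≤ Q`. -/
def mulExponent {m n : ℕ} (X : Matrix (Fin m) (Fin n) ℝ) (θ : Fin m → ℝ) : ℝ≥0∞ :=
  ⨆ (w : ℝ≥0) (_ : ∃ᶠ Q : ℝ in atTop, ∃ q : Fin n → ℤ, q ≠ 0 ∧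
      ∏ j, |centered (linForms X θ q) j| < Q ^ (-(w : ℝ)) ∧
      ∏ i, max 1 |(q i : ℝ)| ≤ Q), (w : ℝ≥0∞)

/-! ### Extremal measures on `ℝ^n` -/

/-- A point of `ℝ^n` as an `n × 1` matrix (simultaneous approximation). -/
def col {n : ℕ} (x : EuclideanSpace ℝ (Fin n)) : Matrix (Fin n) (Fin 1) ℝ :=
  Matrix.of fun i _ => x i

/-- A point of `ℝ^n` as a `1 × n` matrix (dual approximation). -/
def row {n : ℕ} (x : EuclideanSpace ℝ (Fin n)) : Matrix (Fin 1) (Fin n) ℝ :=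
  Matrix.of fun _ i => x i

variable {n : ℕ}

/-- `μ` is extremal, with `ℝ^n` identified with columns. -/
def SimExtremal (μ : Measure (EuclideanSpace ℝ (Fin n))) : Prop :=
  ∀ᵐ x ∂μ, exponent (col x) 0 = 1

/-- `μ` is extremal, with `ℝ^n` identified with rows. -/
def DualExtremal (μ : Measure (EuclideanSpace ℝ (Fin n))) : Prop :=
  ∀ᵐ x ∂μ, exponent (row x) 0 = 1

/-- `μ` is strongly extremal, with `ℝ^n` identified with columns. -/
def SimStronglyExtremal (μ : Measure (EuclideanSpace ℝ (Fin n))) : Prop :=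
  ∀ᵐ x ∂μ, mulExponent (col x) 0 = 1

/-- `μ` is strongly extremal, with `ℝ^n` identified with rows. -/
def DualStronglyExtremal (μ : Measure (EuclideanSpace ℝ (Fin n))) : Prop :=
  ∀ᵐ x ∂μ, mulExponent (row x) 0 = 1

/-- `μ` is simultaneously inhomogeneously extremal. -/
def SimInhomExtremal (μ : Measure (EuclideanSpace ℝ (Fin n))) : Prop :=
  ∀ θ : Fin n → ℝ, ∀ᵐ x ∂μ, exponent (col x) θ = 1

/-- `μ` is simultaneously inhomogeneously strongly extremal. -/
def SimInhomStronglyExtremal (μ : Measure (EuclideanSpace ℝ (Fin n))) : Prop :=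
  ∀ θ : Fin n → ℝ, ∀ᵐ x ∂μ, mulExponent (col x) θ = 1

/-! ### Differentiable submanifolds of `ℝ^n` -/

/-- `f`, on the open set `U ⊆ ℝ^d`, is a (regular, `C^1`) local parametrization of `M`: an
immersion that maps `U` homeomorphically onto a relatively open subset of `M`. -/
structure IsLocalParam (d : ℕ) (M : Set (EuclideanSpace ℝ (Fin n)))
    (U : Set (EuclideanSpace ℝ (Fin d)))
    (f : EuclideanSpace ℝ (Fin d) → EuclideanSpace ℝ (Fin n)) : Prop where
  isOpen : IsOpen U
  contDiffOn : ContDiffOn ℝ 1 f U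
  injective_fderiv : ∀ u ∈ U, Function.Injective (fderiv ℝ f u)
  isEmbedding : IsEmbedding (U.domRestrict f)
  image_eq : ∃ V : Set (EuclideanSpace ℝ (Fin n)), IsOpen V ∧ f '' U = M ∩ V

/-- `M` is a differentiable (that is, `C^1`, embedded) submanifold of `ℝ^n` of dimension `d`. -/
def IsSubmanifold (d : ℕ) (M : Set (EuclideanSpace ℝ (Fin n))) : Prop :=
  ∀ y ∈ M, ∃ U f, IsLocalParam d M U f ∧ y ∈ f '' U

/-- The tangent plane (through the origin) of `M` at `y`: the vectors `Df(u) v`, where `f` is a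
local parametrization of `M` with `f u = y`. -/
def tangentPlane (d : ℕ) (M : Set (EuclideanSpace ℝ (Fin n))) (y : EuclideanSpace ℝ (Fin n)) :
    Set (EuclideanSpace ℝ (Fin n)) :=
  {t | ∃ U f, IsLocalParam d M U f ∧ ∃ u ∈ U, f u = y ∧ ∃ v, fderiv ℝ f u v = t}

/-- The set `T` of vectors is orthogonal to the `i`-th coordinate axis. -/
def OrthogonalToAxis (T : Set (EuclideanSpace ℝ (Fin n))) (i : Fin n) : Prop :=
  ∀ t ∈ T, inner ℝ t (EuclideanSpace.single i (1 : ℝ)) = 0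

/-- The Riemannian measure on a `d`-dimensional submanifold `M`, as a measure on `ℝ^n`: the
`d`-dimensional volume of `ℝ^n` (`d`-dimensional Hausdorff measure, normalized to agree with
Lebesgue measure on `ℝ^d`) restricted to `M`. -/
def riemannianMeasure (d : ℕ) (M : Set (EuclideanSpace ℝ (Fin n))) :
    Measure (EuclideanSpace ℝ (Fin n)) :=
  (μHE[d] : Measure (EuclideanSpace ℝ (Fin n))).restrict M

end DiophantineSubmanifold

end

/-! Each exponent is shown to equal 1 by separate upper and lower bounds, and three facts carry the
argument.

Rows and columns agree. A good simultaneous denominator `q` of `x` yields a good dual vector `k` by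
the pigeonhole principle modulo `q` (`exists_dual_approx`). Conversely, `k` yields `q` by a
pigeonhole in which one coordinate records a residue modulo `k i` (`exists_sim_approx`). Either way
an exponent above 1 stays above 1. With Dirichlet's lower bounds, both identifications give the same
homogeneous notions, so only columns remain.

Lower bounds hold pointwise. If `w(x, 0) ≤ 1`, the multiples `q x` with `|q| ≤ N` are well separated
modulo 1. A packing argument along the segment from `0` to a target (`exists_inhom_approx`) then
shows that slightly more multiples reach every point, so `w(x, θ) ≥ 1`, and `w^× ≥ w`.

Upper bounds hold almost everywhere. Two inhomogeneous approximations of one point subtract to a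
homogeneous one. In a chart, fix a height `2 ^ t` and a set `G` of points without homogeneous
approximations in boxes of sides `4 A i`. The subsets of `G` where `q x + θ` is `2 A i`-close to the
integers are then disjoint for different `q`. Around a density point of `G`, the set where it is `a
i`-close fills only a proportion of order `a j / A j` of such a subset, provided that coordinate `j`
moves at a definite rate in some direction (`measure_iUnion_inhom_le`). Summing over `q` and then
over `t`, Borel-Cantelli and Lebesgue density finish (`ae_eventually_exists_le_distInt`);
bi-Lipschitz charts carry null sets to `M`.

The coordinate `j` must be one of the shortest sides of the box. For (A) all sides are equal, and an
immersion always moves some coordinate. For (B) a region of small product is covered by finitely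
many kinds of boxes (`exists_profile`), any coordinate may be the shortest, and so no axis may be
orthogonal to the tangent plane. -/

namespace DiophantineSubmanifold

/-! ### Powers of a large real number -/

/-- Constants are absorbed throughout by a small loss in the exponent. -/
lemma eventually_const_mul_rpow_le (C : ℝ) {a b : ℝ} (h : a < b) :
    ∀ᶠ Q : ℝ in atTop, C * Q ^ a ≤ Q ^ b := by
  filter_upwards [(tendsto_rpow_atTop (sub_pos.2 h)).eventually_ge_atTop C, eventually_gt_atTop 0]
    with Q hQ h0
  calc C * Q ^ a ≤ Q ^ (b - a) * Q ^ a := by gcongr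
    _ = Q ^ b := by rw [← Real.rpow_add h0]; congr 1; ring

lemma eventually_const_mul_rpow_lt (C : ℝ) {a b : ℝ} (h : a < b) :
    ∀ᶠ Q : ℝ in atTop, C * Q ^ a < Q ^ b := by
  filter_upwards [eventually_const_mul_rpow_le (C + 1) h, eventually_gt_atTop 0] with Q hQ h0
  have : 0 < Q ^ a := Real.rpow_pos_of_pos h0 _
  nlinarith

/-! ### A common form of the two exponents -/

/-- The supremum of the `w ≥ 0` such that `A i < Q ^ (-w)` and `B i ≤ Q` for some admissible `i`,
for arbitrarily large `Q`. -/
noncomputable def exponentOf {ι : Type*} (N : ι → Prop) (A B : ι → ℝ) : ℝ≥0∞ :=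
  ⨆ (w : ℝ≥0) (_ : ∃ᶠ Q : ℝ in atTop, ∃ i, N i ∧ A i < Q ^ (-(w : ℝ)) ∧ B i ≤ Q), (w : ℝ≥0∞)

lemma exponentOf_le_one_iff {ι : Type*} {N : ι → Prop} {A B : ι → ℝ} :
    exponentOf N A B ≤ 1 ↔
      ∀ ε : ℝ, 0 < ε → ∀ᶠ Q : ℝ in atTop, ∀ i, N i → B i ≤ Q → Q ^ (-(1 + ε)) ≤ A i := by
  unfold exponentOf
  rw [iSup₂_le_iff]
  constructor
  · intro h ε hε
    by_contra hcon
    have hc : ((1 + ε).toNNReal : ℝ) = 1 + ε := Real.coe_toNNReal _ (by positivity)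
    have h1 := h (1 + ε).toNNReal (by
      refine (not_eventually.1 hcon).mono fun Q hQ => ?_
      push Not at hQ
      obtain ⟨i, h1, h2, h3⟩ := hQ
      exact ⟨i, h1, by rwa [hc], h2⟩)
    rw [ENNReal.coe_le_one_iff] at h1
    have h2 : ((1 + ε).toNNReal : ℝ) ≤ 1 := by exact_mod_cast h1
    linarith
  · intro h w hw
    rw [ENNReal.coe_le_one_iff]
    by_contra! hw1
    have hw1' : (1 : ℝ) < w := by exact_mod_cast hw1
    obtain ⟨Q, ⟨i, hN, hA, hB⟩, h2⟩ := (hw.and_eventually (h (w - 1) (by linarith))).exists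
    have := h2 i hN hB
    rw [add_sub_cancel] at this
    linarith

lemma one_le_exponentOf {ι : Type*} {N : ι → Prop} {A B : ι → ℝ}
    (h : ∀ w : ℝ, 0 < w → w < 1 → ∃ᶠ Q : ℝ in atTop, ∃ i, N i ∧ A i < Q ^ (-w) ∧ B i ≤ Q) :
    1 ≤ exponentOf N A B := by
  refine le_of_forall_lt fun c hc => ?_
  obtain ⟨w, hcw, hw1⟩ := exists_between hc
  lift w to ℝ≥0 using (hw1.trans ENNReal.one_lt_top).ne
  have hw0 : 0 < w := by
    have := (zero_le (a := c)).trans_lt hcw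
    exact_mod_cast this
  refine hcw.trans_le ?_
  unfold exponentOf
  exact le_iSup₂_of_le w (h w (by exact_mod_cast hw0) (by exact_mod_cast hw1)) le_rfl

lemma exponentOf_mono {ι : Type*} {N : ι → Prop} {A B A' B' : ι → ℝ}
    (hA : ∀ i, N i → A' i ≤ A i) (hB : ∀ i, N i → B' i ≤ B i) :
    exponentOf N A B ≤ exponentOf N A' B' := by
  unfold exponentOf
  refine iSup_le fun w => iSup_le fun hw => le_iSup₂_of_le w ?_ le_rfl
  refine hw.mono fun Q => ?_
  rintro ⟨i, h1, h2, h3⟩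
  exact ⟨i, h1, (hA i h1).trans_lt h2, (hB i h1).trans h3⟩

lemma exponent_eq_exponentOf {m n : ℕ} (X : Matrix (Fin m) (Fin n) ℝ) (θ : Fin m → ℝ) :
    exponent X θ = exponentOf (fun q : Fin n → ℤ => q ≠ 0)
      (fun q => ‖centered (linForms X θ q)‖ ^ m) (fun q => ‖fun i => (q i : ℝ)‖ ^ n) := rfl

lemma mulExponent_eq_exponentOf {m n : ℕ} (X : Matrix (Fin m) (Fin n) ℝ) (θ : Fin m → ℝ) :
    mulExponent X θ = exponentOf (fun q : Fin n → ℤ => q ≠ 0)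
      (fun q => ∏ j, |centered (linForms X θ q) j|) (fun q => ∏ i, max 1 |(q i : ℝ)|) := rfl

/-- A product is at most a power of the largest factor; on the side of `q`, a nonzero integer vector
has sup norm at least 1, which takes care of the `max 1`. -/
lemma exponent_le_mulExponent {m n : ℕ} (X : Matrix (Fin m) (Fin n) ℝ) (θ : Fin m → ℝ) :
    exponent X θ ≤ mulExponent X θ := by
  rw [exponent_eq_exponentOf, mulExponent_eq_exponentOf]
  refine exponentOf_mono (fun q _ => ?_) fun q hq => ?_
  · calc ∏ j, |centered (linForms X θ q) j| ≤ ∏ _j : Fin m, ‖centered (linForms X θ q)‖ :=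
          Finset.prod_le_prod (fun _ _ => abs_nonneg _) fun j _ =>
            norm_le_pi_norm (centered (linForms X θ q)) j
      _ = _ := by simp
  · obtain ⟨i, hi⟩ := Function.ne_iff.1 hq
    have h1 : (1 : ℝ) ≤ ‖fun i => (q i : ℝ)‖ := by
      refine le_trans ?_ (norm_le_pi_norm (fun i => (q i : ℝ)) i)
      rw [Real.norm_eq_abs]
      exact_mod_cast Int.one_le_abs hi
    calc ∏ i, max 1 |(q i : ℝ)| ≤ ∏ _i : Fin n, ‖fun i => (q i : ℝ)‖ :=
          Finset.prod_le_prod (fun _ _ => by positivity) fun j _ =>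
            max_le h1 (norm_le_pi_norm (fun i => (q i : ℝ)) j)
      _ = _ := by simp

/-! ### Distance to the nearest integer -/

/-- The distance from a real number to the nearest integer. -/
noncomputable def distInt (y : ℝ) : ℝ := |y - round y|

lemma distInt_nonneg (y : ℝ) : 0 ≤ distInt y := abs_nonneg _

lemma distInt_le (y : ℝ) (p : ℤ) : distInt y ≤ |y - p| := round_le y p

lemma distInt_le_abs (y : ℝ) : distInt y ≤ |y| := by simpa using distInt_le y 0

lemma distInt_le_half (y : ℝ) : distInt y ≤ 1 / 2 := abs_sub_round y

lemma distInt_add_le (x y : ℝ) : distInt (x + y) ≤ distInt x + distInt y := by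
  refine (distInt_le (x + y) (round x + round y)).trans ?_
  rw [show x + y - ((round x + round y : ℤ) : ℝ) = (x - round x) + (y - round y) by
    push_cast; ring]
  exact abs_add_le _ _

lemma distInt_neg (x : ℝ) : distInt (-x) = distInt x := by
  have key : ∀ y, distInt (-y) ≤ distInt y := fun y => by
    refine (distInt_le (-y) (-round y)).trans_eq ?_
    rw [distInt, ← abs_neg]; congr 1; push_cast; ring
  exact le_antisymm (key x) (by simpa using key (-x))

lemma distInt_sub_le (x y : ℝ) : distInt (x - y) ≤ distInt x + distInt y := by
  simpa [sub_eq_add_neg, distInt_neg] using distInt_add_le x (-y)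

lemma distInt_le_add_abs_sub (x y : ℝ) : distInt x ≤ distInt y + |x - y| := by
  have := distInt_add_le y (x - y)
  have := distInt_le_abs (x - y)
  rw [add_sub_cancel] at *
  linarith

lemma continuous_distInt : Continuous distInt := by
  refine LipschitzWith.continuous (K := 1) (LipschitzWith.of_le_add fun x y => ?_)
  simpa [Real.dist_eq] using distInt_le_add_abs_sub x y

lemma distInt_sub_le_of_fract (u v : ℝ) : distInt (u - v) ≤ |Int.fract u - Int.fract v| := by
  refine (distInt_le (u - v) (⌊u⌋ - ⌊v⌋)).trans_eq ?_
  simp only [Int.fract]; congr 1; push_cast; ring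

/-! ### The pigeonhole principle on a torus -/

/-- Coordinate `i` is cut into `M i` cells. The numbers may differ, because the multiplicative
transference needs unequal sides and because a coordinate may encode a residue class. -/
lemma exists_ne_abs_fract_sub_lt {α ι : Type*} [Fintype ι] (s : Finset α) (u : α → ι → ℝ)
    (M : ι → ℕ) (hM : ∀ i, 0 < M i) (hs : ∏ i, M i < s.card) :
    ∃ a ∈ s, ∃ b ∈ s, a ≠ b ∧ ∀ i, |Int.fract (u a i) - Int.fract (u b i)| < 1 / M i := by
  classical
  have hcard : (Fintype.piFinset fun i => Finset.range (M i)).card < s.card := by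
    simpa [Fintype.card_piFinset] using hs
  obtain ⟨a, ha, b, hb, hab, h⟩ := Finset.exists_ne_map_eq_of_card_lt_of_maps_to hcard
    (f := fun a i => ⌊Int.fract (u a i) * M i⌋₊) (by
      intro a _
      simp only [Finset.mem_coe, Fintype.mem_piFinset, Finset.mem_range]
      intro i
      have hMi : (0 : ℝ) < M i := by exact_mod_cast hM i
      rw [Nat.floor_lt (mul_nonneg (Int.fract_nonneg _) hMi.le)]
      nlinarith [Int.fract_lt_one (u a i)])
  refine ⟨a, ha, b, hb, hab, fun i => ?_⟩
  have hMi : (0 : ℝ) < M i := by exact_mod_cast hM i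
  have hi := congrFun h i
  have h1 := Nat.floor_le (mul_nonneg (Int.fract_nonneg (u a i)) hMi.le)
  have h2 := Nat.lt_floor_add_one (Int.fract (u a i) * M i)
  have h3 := Nat.floor_le (mul_nonneg (Int.fract_nonneg (u b i)) hMi.le)
  have h4 := Nat.lt_floor_add_one (Int.fract (u b i) * M i)
  rw [← hi] at h3 h4
  rw [lt_div_iff₀ hMi, ← abs_of_pos hMi, ← abs_mul, sub_mul, abs_sub_lt_iff]
  constructor <;> linarith

/-- Fractions with denominator `k` are equal modulo `1` once they are close enough. -/
lemma dvd_sub_of_abs_fract_sub_lt {a b k : ℤ} (hk : k ≠ 0)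
    (h : |Int.fract ((a : ℝ) / k) - Int.fract ((b : ℝ) / k)| < 1 / |(k : ℝ)|) : k ∣ a - b := by
  have hk' : (k : ℝ) ≠ 0 := by exact_mod_cast hk
  refine ⟨⌊(a : ℝ) / k⌋ - ⌊(b : ℝ) / k⌋, ?_⟩
  rw [lt_div_iff₀ (abs_pos.2 hk'), ← abs_mul] at h
  have h2 : (Int.fract ((a : ℝ) / k) - Int.fract ((b : ℝ) / k)) * k =
      ((a - b - k * (⌊(a : ℝ) / k⌋ - ⌊(b : ℝ) / k⌋) : ℤ) : ℝ) := by
    simp only [Int.fract]; push_cast; field_simp; ring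
  rw [h2] at h
  have h3 : |a - b - k * (⌊(a : ℝ) / k⌋ - ⌊(b : ℝ) / k⌋)| < 1 := by exact_mod_cast h
  have := Int.abs_lt_one_iff.1 h3
  linarith

/-! ### The conditions "exponent at most one" in coordinates -/

/-- `w(x, θ) ≤ 1`, for a column `x`. -/
def SimUpper {n : ℕ} (x θ : Fin n → ℝ) : Prop :=
  ∀ ε : ℝ, 0 < ε → ∀ᶠ Q : ℝ in atTop, ∀ q : ℤ, q ≠ 0 → |(q : ℝ)| ≤ Q →
    ∃ j, Q ^ (-((1 + ε) / n)) ≤ distInt (q * x j + θ j)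

/-- `w(x, 0) ≤ 1`, for a row `x`. -/
def DualUpper {n : ℕ} (x : Fin n → ℝ) : Prop :=
  ∀ ε : ℝ, 0 < ε → ∀ᶠ Q : ℝ in atTop, ∀ k : Fin n → ℤ, k ≠ 0 → (∀ i, |(k i : ℝ)| ^ n ≤ Q) →
    Q ^ (-(1 + ε)) ≤ distInt (∑ i, k i * x i)

/-- `w^×(x, θ) ≤ 1`, for a column `x`. -/
def MulSimUpper {n : ℕ} (x θ : Fin n → ℝ) : Prop :=
  ∀ ε : ℝ, 0 < ε → ∀ᶠ Q : ℝ in atTop, ∀ q : ℤ, q ≠ 0 → |(q : ℝ)| ≤ Q →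
    Q ^ (-(1 + ε)) ≤ ∏ j, distInt (q * x j + θ j)

/-- `w^×(x, 0) ≤ 1`, for a row `x`. -/
def MulDualUpper {n : ℕ} (x : Fin n → ℝ) : Prop :=
  ∀ ε : ℝ, 0 < ε → ∀ᶠ Q : ℝ in atTop, ∀ k : Fin n → ℤ, k ≠ 0 →
    ∏ i, max 1 |(k i : ℝ)| ≤ Q → Q ^ (-(1 + ε)) ≤ distInt (∑ i, k i * x i)

lemma abs_centered {m : ℕ} (y : Fin m → ℝ) (j : Fin m) : |centered y j| = distInt (y j) := rfl

lemma linForms_col {n : ℕ} (x : EuclideanSpace ℝ (Fin n)) (θ : Fin n → ℝ) (q : Fin 1 → ℤ)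
    (j : Fin n) : linForms (col x) θ q j = q 0 * x j + θ j := by
  simp [linForms, col, Matrix.mulVec, dotProduct, mul_comm]

lemma linForms_row {n : ℕ} (x : EuclideanSpace ℝ (Fin n)) (q : Fin n → ℤ) (j : Fin 1) :
    linForms (row x) 0 q j = ∑ i, q i * x i := by
  simp [linForms, row, Matrix.mulVec, dotProduct, mul_comm]

lemma norm_pow_lt_rpow_iff {n : ℕ} (hn : 0 < n) (y : Fin n → ℝ) {Q : ℝ} (hQ : 0 < Q) (s : ℝ) :
    ‖y‖ ^ n < Q ^ (-s) ↔ ∀ j, |y j| < Q ^ (-(s / n)) := by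
  have h1 : Q ^ (-s) = (Q ^ (-(s / n))) ^ n := by
    rw [← Real.rpow_natCast, ← Real.rpow_mul hQ.le]
    congr 1
    have : (n : ℝ) ≠ 0 := by positivity
    field_simp
  rw [h1, pow_lt_pow_iff_left₀ (norm_nonneg _) (by positivity) hn.ne',
    pi_norm_lt_iff (by positivity)]
  rfl

lemma fin_one_ne_zero_iff (q : Fin 1 → ℤ) : q ≠ 0 ↔ q 0 ≠ 0 := by
  rw [Ne, funext_iff]; simp

lemma norm_intCast_fin_one (q : Fin 1 → ℤ) : ‖fun i => (q i : ℝ)‖ ^ 1 = |(q 0 : ℝ)| := by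
  simp [Pi.norm_def]

lemma exponent_col_le_one_iff {n : ℕ} (hn : 0 < n) (x : EuclideanSpace ℝ (Fin n))
    (θ : Fin n → ℝ) : exponent (col x) θ ≤ 1 ↔ SimUpper x.ofLp θ := by
  rw [exponent_eq_exponentOf, exponentOf_le_one_iff]
  refine forall₂_congr fun ε _ => eventually_congr ?_
  filter_upwards [eventually_gt_atTop 0] with Q hQ
  have key (q : Fin 1 → ℤ) : Q ^ (-(1 + ε)) ≤ ‖centered (linForms (col x) θ q)‖ ^ n ↔
      ∃ j, Q ^ (-((1 + ε) / n)) ≤ distInt (q 0 * x j + θ j) := by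
    rw [← not_lt, norm_pow_lt_rpow_iff hn _ hQ]
    simp only [abs_centered, linForms_col, not_forall, not_lt]
  constructor
  · intro h q hq hqQ
    have := (key fun _ => q).1
      (h _ ((fin_one_ne_zero_iff _).2 hq) (by rw [norm_intCast_fin_one]; exact hqQ))
    exact this
  · intro h q hq hqQ
    rw [norm_intCast_fin_one] at hqQ
    exact (key q).2 (h _ ((fin_one_ne_zero_iff _).1 hq) hqQ)

lemma mulExponent_col_le_one_iff {n : ℕ} (x : EuclideanSpace ℝ (Fin n))
    (θ : Fin n → ℝ) : mulExponent (col x) θ ≤ 1 ↔ MulSimUpper x.ofLp θ := by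
  rw [mulExponent_eq_exponentOf, exponentOf_le_one_iff]
  refine forall₂_congr fun ε _ => eventually_congr ?_
  filter_upwards [eventually_gt_atTop 0] with Q hQ
  have hmax {a : ℤ} (ha : a ≠ 0) : max 1 |(a : ℝ)| = |(a : ℝ)| :=
    max_eq_right (by exact_mod_cast Int.one_le_abs ha)
  simp only [abs_centered, linForms_col]
  constructor
  · intro h q hq hqQ
    have := h (fun _ => q) ((fin_one_ne_zero_iff _).2 hq)
    simp only [Fin.prod_univ_one] at this
    exact this (by rwa [hmax hq])
  · intro h q hq hqQ
    have hq' := (fin_one_ne_zero_iff _).1 hq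
    rw [Fin.prod_univ_one, hmax hq'] at hqQ
    exact h _ hq' hqQ

lemma exponent_row_le_one_iff {n : ℕ} (hn : 0 < n) (x : EuclideanSpace ℝ (Fin n)) :
    exponent (row x) 0 ≤ 1 ↔ DualUpper x.ofLp := by
  rw [exponent_eq_exponentOf, exponentOf_le_one_iff]
  refine forall₂_congr fun ε _ => eventually_congr ?_
  filter_upwards [eventually_gt_atTop 0] with Q hQ
  refine forall₂_congr fun q _ => ?_
  have : Nonempty (Fin n) := ⟨⟨0, hn⟩⟩
  have h1 : ‖fun i => (q i : ℝ)‖ ^ n ≤ Q ↔ ∀ i, |(q i : ℝ)| ^ n ≤ Q := by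
    constructor
    · intro h i
      exact (pow_le_pow_left₀ (abs_nonneg _) (norm_le_pi_norm (fun i => (q i : ℝ)) i) n).trans h
    · intro h
      obtain ⟨i, -, hi⟩ := Finset.exists_mem_eq_sup' Finset.univ_nonempty (fun i => |(q i : ℝ)|)
      have : ‖fun i => (q i : ℝ)‖ ≤ |(q i : ℝ)| :=
        (pi_norm_le_iff_of_nonempty _).2 fun j => hi ▸ Finset.le_sup' (fun i => |(q i : ℝ)|)
          (Finset.mem_univ j)
      exact (pow_le_pow_left₀ (norm_nonneg _) this n).trans (h i)
  have h2 : ‖centered (linForms (row x) 0 q)‖ ^ 1 = distInt (∑ i, q i * x i) := by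
    rw [← linForms_row x q 0, ← abs_centered]
    simp [Pi.norm_def]
  rw [h1, h2]

lemma mulExponent_row_le_one_iff {n : ℕ} (x : EuclideanSpace ℝ (Fin n)) :
    mulExponent (row x) 0 ≤ 1 ↔ MulDualUpper x.ofLp := by
  rw [mulExponent_eq_exponentOf, exponentOf_le_one_iff]
  refine forall₂_congr fun ε _ => eventually_congr (Eventually.of_forall fun Q => ?_)
  refine forall₂_congr fun q _ => ?_
  simp only [abs_centered, linForms_row, Fin.prod_univ_one]

/-! ### From simultaneous to dual approximations -/

/-- If `q` is a good simultaneous denominator of `x`, then there are small integer vectors `k`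
with `∑ k i * x i` close to an integer. -/
lemma exists_dual_approx {n : ℕ} (x : Fin n → ℝ) {q : ℤ} (hq : q ≠ 0) (K : Fin n → ℕ)
    (hK : |(q : ℝ)| < ∏ j, ((K j : ℝ) + 1)) :
    ∃ k : Fin n → ℤ, k ≠ 0 ∧ (∀ j, |(k j : ℝ)| ≤ K j) ∧
      |(q : ℝ)| * distInt (∑ j, k j * x j) ≤ ∑ j, K j * distInt (q * x j) := by
  set p : Fin n → ℤ := fun j => round (q * x j) with hp
  have hq0 : (q : ℝ) ≠ 0 := by exact_mod_cast hq
  -- The box has more than `|q|` points `a`, so two of the sums `∑ a j * p j` agree modulo `q`.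
  -- Their difference `k` has `∑ k j * p j = q * c`, whence `q * (∑ k j * x j - c) = ∑ k j * (q * x
  -- j - p j)`.
  obtain ⟨a, ha, b, hb, hab, h⟩ := exists_ne_abs_fract_sub_lt
    (Fintype.piFinset fun j => Finset.range (K j + 1))
    (fun a (_ : Unit) => (((∑ j, (a j : ℤ) * p j : ℤ) : ℝ)) / q) (fun _ => q.natAbs)
    (fun _ => Int.natAbs_pos.2 hq) (by
      have h1 : ((q.natAbs : ℕ) : ℝ) = |(q : ℝ)| := by
        rw [← Int.cast_abs, Int.abs_eq_natAbs]; simp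
      simp only [Finset.univ_unique, Finset.prod_const, Finset.card_singleton, pow_one,
        Fintype.card_piFinset, Finset.card_range]
      have h2 : ((q.natAbs : ℕ) : ℝ) < ((∏ j, (K j + 1) : ℕ) : ℝ) := by
        rw [h1]; push_cast; exact hK
      exact_mod_cast h2)
  have h1 := h ()
  rw [show ((q.natAbs : ℕ) : ℝ) = |(q : ℝ)| by
    rw [← Int.cast_abs, Int.abs_eq_natAbs]; simp] at h1
  obtain ⟨c, hc⟩ := dvd_sub_of_abs_fract_sub_lt hq h1
  have hk (j) : |(((a j : ℤ) - b j : ℤ) : ℝ)| ≤ K j := by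
    have h1 := Finset.mem_range.1 (Fintype.mem_piFinset.1 ha j)
    have h2 := Finset.mem_range.1 (Fintype.mem_piFinset.1 hb j)
    have : |(a j : ℤ) - b j| ≤ K j := by rw [abs_le]; omega
    exact_mod_cast this
  refine ⟨fun j => (a j : ℤ) - b j, ?_, hk, ?_⟩
  · intro h0
    exact hab (funext fun j => by have := congrFun h0 j; simp only [Pi.zero_apply] at this; omega)
  · have hc' : ∑ j, (((a j : ℤ) - b j : ℤ) : ℝ) * p j = q * c := by
      have : ∑ j, ((a j : ℤ) - b j) * p j = q * c := by
        rw [← hc, ← Finset.sum_sub_distrib]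
        exact Finset.sum_congr rfl fun j _ => by ring
      exact_mod_cast this
    calc |(q : ℝ)| * distInt (∑ j, (((a j : ℤ) - b j : ℤ) : ℝ) * x j)
        ≤ |(q : ℝ)| * |∑ j, (((a j : ℤ) - b j : ℤ) : ℝ) * x j - c| := by
          gcongr; exact distInt_le _ _
      _ = |∑ j, (((a j : ℤ) - b j : ℤ) : ℝ) * (q * x j - p j)| := by
          rw [← abs_mul]; congr 1
          simp only [mul_sub, Finset.sum_sub_distrib]
          rw [hc', Finset.mul_sum]
          congr 1
          exact Finset.sum_congr rfl fun j _ => by ring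
      _ ≤ ∑ j, |(((a j : ℤ) - b j : ℤ) : ℝ) * (q * x j - p j)| := Finset.abs_sum_le_sum_abs _ _
      _ ≤ _ := by
          refine Finset.sum_le_sum fun j _ => ?_
          rw [abs_mul]
          exact mul_le_mul_of_nonneg_right (hk j) (abs_nonneg _)

/-- Here `a` plays the role of `|q|`. Since `a ≤ Q`, the power `δ / (1 + δ)` of `2 * a * Q ^ δ` is
at most `2 * Q ^ δ`, so the right side is at least `Q ^ (-2δ) / (4 * a)`; the remaining `Q ^ (-δ)`
absorbs `4 * c`. -/
lemma eventually_dual_bound (c : ℝ) {δ : ℝ} (hδ : 0 < δ) :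
    ∀ᶠ Q : ℝ in atTop, ∀ a : ℝ, 1 ≤ a → a ≤ Q →
      c * Q ^ (-(3 * δ)) / a < (2 * (a * Q ^ δ)) ^ (-(1 + δ / (1 + δ))) := by
  filter_upwards [eventually_const_mul_rpow_lt (4 * c) (neg_lt_zero.2 hδ), eventually_ge_atTop 1]
    with Q hQ h1 a ha haQ
  have hQ0 : 0 < Q := by linarith
  have ha0 : 0 < a := by linarith
  have hδ' : 0 ≤ δ / (1 + δ) := by positivity
  have hδ1 : δ / (1 + δ) ≤ 1 := by rw [div_le_one (by positivity)]; linarith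
  have e1 : (2 * (a * Q ^ δ)) ^ (δ / (1 + δ)) ≤ 2 * Q ^ δ := by
    calc (2 * (a * Q ^ δ)) ^ (δ / (1 + δ)) ≤ (2 * Q ^ (1 + δ)) ^ (δ / (1 + δ)) := by
          refine Real.rpow_le_rpow (by positivity) ?_ hδ'
          rw [Real.rpow_add hQ0, Real.rpow_one]; gcongr
      _ = 2 ^ (δ / (1 + δ)) * Q ^ δ := by
          rw [Real.mul_rpow (by norm_num) (by positivity), ← Real.rpow_mul hQ0.le]
          congr 2; field_simp
      _ ≤ 2 ^ (1 : ℝ) * Q ^ δ := by gcongr; norm_num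
      _ = _ := by simp
  rw [Real.rpow_neg (x := 2 * (a * Q ^ δ)) (by positivity), Real.rpow_add (by positivity),
    Real.rpow_one, div_lt_iff₀ ha0, Real.rpow_neg hQ0.le]
  have e2 : 0 < Q ^ δ := by positivity
  rw [Real.rpow_zero, Real.rpow_neg hQ0.le, ← div_eq_mul_inv, div_lt_one e2] at hQ
  have e3 : Q ^ (3 * δ) = Q ^ δ * Q ^ δ * Q ^ δ := by
    rw [← Real.rpow_add hQ0, ← Real.rpow_add hQ0]; congr 1; ring
  rw [e3]
  have e4 : (2 * (a * Q ^ δ) * (2 * Q ^ δ))⁻¹ * a ≤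
      (2 * (a * Q ^ δ) * (2 * (a * Q ^ δ)) ^ (δ / (1 + δ)))⁻¹ * a := by
    gcongr
  refine lt_of_lt_of_le ?_ e4
  rw [← div_eq_mul_inv, inv_mul_eq_div, div_lt_div_iff₀ (by positivity) (by positivity)]
  have := mul_lt_mul_of_pos_right hQ (show 0 < a * (Q ^ δ * Q ^ δ) by positivity)
  nlinarith

/-- The common ending of the two transferences from dual to simultaneous approximation. -/
lemma eventually_dual_contradiction {n : ℕ} {x : Fin n → ℝ} {P : ℝ → (Fin n → ℤ) → Prop} {δ : ℝ}
    (hδ : 0 < δ)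
    (h : ∀ᶠ Q : ℝ in atTop, ∀ k : Fin n → ℤ, k ≠ 0 → P Q k →
      Q ^ (-(1 + δ / (1 + δ))) ≤ distInt (∑ i, k i * x i)) :
    ∀ᶠ Q : ℝ in atTop, ∀ q : ℤ, q ≠ 0 → |(q : ℝ)| ≤ Q → ∀ K : Fin n → ℕ,
      |(q : ℝ)| < ∏ j, ((K j : ℝ) + 1) → (∀ j, K j * distInt (q * x j) ≤ Q ^ (-(3 * δ))) →
      (∀ k : Fin n → ℤ, (∀ j, |(k j : ℝ)| ≤ K j) → P (2 * (|(q : ℝ)| * Q ^ δ)) k) → False := by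
  obtain ⟨Q₀, hQ₀⟩ := eventually_atTop.1 h
  filter_upwards [eventually_dual_bound n hδ, (tendsto_rpow_atTop hδ).eventually_ge_atTop Q₀,
    eventually_ge_atTop 1] with Q h1 h2 hQ1 q hq hqQ K hK hKd hP
  have ha : (1 : ℝ) ≤ |(q : ℝ)| := by exact_mod_cast Int.one_le_abs hq
  obtain ⟨k, hk0, hkK, hk⟩ := exists_dual_approx x hq K hK
  have hQδ : 0 < Q ^ δ := by positivity
  -- The factor `Q ^ δ` brings the height above `Q₀` uniformly in `q`, however small `|q|` is.
  have h3 := hQ₀ (2 * (|(q : ℝ)| * Q ^ δ)) (by nlinarith) k hk0 (hP k hkK)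
  have h4 := (h1 _ ha hqQ).trans_le h3
  rw [div_lt_iff₀ (by linarith)] at h4
  have h5 : ∑ j, K j * distInt (q * x j) ≤ n * Q ^ (-(3 * δ)) := by
    simpa using Finset.sum_le_sum fun j (_ : j ∈ Finset.univ) => hKd j
  linarith

/-- Take the admissible `K` of least sum. Admissible ones exist: `⌊l / a j⌋` if all `a j` are
positive, and otherwise a long side in a coordinate with `a i = 0`. -/
lemma exists_box {n : ℕ} (a : Fin n → ℝ) (ha : ∀ j, 0 ≤ a j) {l Y : ℝ} (hl : 0 < l) (hY : 1 ≤ Y)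
    (h : Y * ∏ j, a j < l ^ n) :
    ∃ K : Fin n → ℕ, Y < ∏ j, ((K j : ℝ) + 1) ∧ ∏ j, ((K j : ℝ) + 1) ≤ 2 * Y ∧
      ∀ j, K j * a j ≤ l := by
  classical
  have hex : ∃ s : ℕ, ∃ K : Fin n → ℕ, (Y < ∏ j, ((K j : ℝ) + 1) ∧ ∀ j, K j * a j ≤ l) ∧
      ∑ j, K j = s := by
    by_cases h0 : ∃ i, a i = 0
    · obtain ⟨i, hi⟩ := h0
      refine ⟨_, Pi.single i ⌈Y⌉₊, ⟨?_, fun j => ?_⟩, rfl⟩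
      · rw [Finset.prod_eq_single i]
        · simp only [Pi.single_eq_same]
          linarith [Nat.le_ceil Y]
        · intro j _ hj; simp [hj]
        · simp
      · by_cases hj : j = i
        · subst hj; simp [hi, hl.le]
        · simp [hj, hl.le]
    · push Not at h0
      have hpos (j) : 0 < a j := lt_of_le_of_ne (ha j) (h0 j).symm
      refine ⟨_, fun j => ⌊l / a j⌋₊, ⟨?_, fun j => ?_⟩, rfl⟩
      · have h1 : Y < ∏ j, l / a j := by
          rw [Finset.prod_div_distrib, lt_div_iff₀ (Finset.prod_pos fun j _ => hpos j)]
          simpa using h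
        refine h1.trans_le (Finset.prod_le_prod (fun j _ => (div_pos hl (hpos j)).le)
          fun j _ => (Nat.lt_floor_add_one _).le)
      · rw [← le_div_iff₀ (hpos j)]
        exact Nat.floor_le (div_pos hl (hpos j)).le
  obtain ⟨K, ⟨hK1, hK2⟩, hKs⟩ := Nat.find_spec hex
  refine ⟨K, hK1, ?_, hK2⟩
  by_contra! hcon
  have hne : ∃ i, K i ≠ 0 := by
    by_contra! h0
    simp [h0] at hK1
    linarith
  obtain ⟨i, hi⟩ := hne
  set K' := Function.update K i (K i - 1) with hK'
  have hK'i : K' i = K i - 1 := by simp [hK']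
  have hK'j {j} (hj : j ≠ i) : K' j = K j := by simp [hK', hj]
  -- Since `K i ≥ 1`, lowering it by one at most halves the factor `K i + 1`; a product above `2 *
  -- Y` would stay above `Y`, against minimality.
  refine Nat.find_min hex (m := ∑ j, K' j) ?_ ⟨K', ⟨?_, fun j => ?_⟩, rfl⟩
  · rw [← hKs]
    refine Finset.sum_lt_sum (fun j _ => ?_) ⟨i, Finset.mem_univ i, by omega⟩
    by_cases hj : j = i
    · subst hj; omega
    · exact (hK'j hj).le
  · rw [← Finset.mul_prod_erase _ _ (Finset.mem_univ i)] at hcon ⊢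
    rw [Finset.prod_congr rfl fun j hj => by rw [hK'j (Finset.ne_of_mem_erase hj)]]
    have hp : 0 < ∏ j ∈ Finset.univ.erase i, ((K j : ℝ) + 1) :=
      Finset.prod_pos fun j _ => by positivity
    have hKi : (1 : ℝ) ≤ K i := by exact_mod_cast Nat.one_le_iff_ne_zero.2 hi
    have : ((K' i : ℕ) : ℝ) = K i - 1 := by
      rw [hK'i, Nat.cast_sub (Nat.one_le_iff_ne_zero.2 hi)]; simp
    rw [this]
    nlinarith
  · by_cases hj : j = i
    · subst hj
      refine le_trans (mul_le_mul_of_nonneg_right ?_ (ha j)) (hK2 j)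
      rw [hK'i]; exact_mod_cast Nat.sub_le _ _
    · rw [hK'j hj]; exact hK2 j

lemma MulDualUpper.mulSimUpper {n : ℕ} (hn : 0 < n) {x : Fin n → ℝ} (h : MulDualUpper x) :
    MulSimUpper x 0 := by
  intro ε hε
  have hn' : (1 : ℝ) ≤ n := by exact_mod_cast hn
  -- With this choice `1 + δ - (1 + ε) = δ - 4nδ ≤ -3δn`, which is what `exists_box` needs for `l =
  -- Q ^ (-3δ)`.
  set δ := ε / (4 * n) with hδ
  have hδ0 : 0 < δ := by positivity
  have hεδ : ε = 4 * n * δ := by rw [hδ]; field_simp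
  filter_upwards [eventually_dual_contradiction hδ0 (h (δ / (1 + δ)) (by positivity)),
    eventually_ge_atTop 1] with Q hQ hQ1 q hq hqQ
  by_contra! hcon
  simp only [Pi.zero_apply, add_zero] at hcon
  have hQ0 : 0 < Q := by linarith
  have ha : (1 : ℝ) ≤ |(q : ℝ)| := by exact_mod_cast Int.one_le_abs hq
  have hQδ : 1 ≤ Q ^ δ := Real.one_le_rpow hQ1 hδ0.le
  have hprod : 0 ≤ ∏ j, distInt (q * x j) := Finset.prod_nonneg fun j _ => distInt_nonneg _
  obtain ⟨K, hK1, hK2, hK3⟩ := exists_box (fun j => distInt (q * x j)) (fun j => distInt_nonneg _)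
    (l := Q ^ (-(3 * δ))) (Y := |(q : ℝ)| * Q ^ δ) (by positivity) (by nlinarith) (by
      calc |(q : ℝ)| * Q ^ δ * ∏ j, distInt (q * x j) ≤ Q * Q ^ δ * ∏ j, distInt (q * x j) := by
            gcongr
        _ < Q * Q ^ δ * Q ^ (-(1 + ε)) := by gcongr
        _ = Q ^ (1 + δ + -(1 + ε)) := by
            rw [Real.rpow_add hQ0, Real.rpow_add hQ0, Real.rpow_one]
        _ ≤ Q ^ (-(3 * δ) * n) := by
            refine Real.rpow_le_rpow_of_exponent_le hQ1 ?_
            rw [hεδ]; nlinarith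
        _ = _ := by rw [Real.rpow_mul hQ0.le, Real.rpow_natCast])
  refine hQ q hq hqQ K (lt_of_le_of_lt (by nlinarith) hK1) hK3 fun k hk => ?_
  refine le_trans (Finset.prod_le_prod (fun j _ => by positivity) fun j _ => ?_) hK2
  exact max_le (by linarith [Nat.cast_nonneg (α := ℝ) (K j)]) (by linarith [hk j])

/-- The box is now a cube: its side `K = ⌊Y ^ (1/n)⌋` satisfies `(K + 1) ^ n > |q|` and keeps every
`|k i| ^ n` below `Y`. -/
lemma DualUpper.simUpper {n : ℕ} (hn : 0 < n) {x : Fin n → ℝ} (h : DualUpper x) :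
    SimUpper x 0 := by
  intro ε hε
  have hn' : (1 : ℝ) ≤ n := by exact_mod_cast hn
  set δ := ε / (4 * n) with hδ
  have hδ0 : 0 < δ := by positivity
  have hεδ : ε = 4 * n * δ := by rw [hδ]; field_simp
  filter_upwards [eventually_dual_contradiction hδ0 (h (δ / (1 + δ)) (by positivity)),
    eventually_ge_atTop 1] with Q hQ hQ1 q hq hqQ
  by_contra! hcon
  simp only [Pi.zero_apply, add_zero] at hcon
  have hQ0 : 0 < Q := by linarith
  have ha : (1 : ℝ) ≤ |(q : ℝ)| := by exact_mod_cast Int.one_le_abs hq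
  have hQδ : 1 ≤ Q ^ δ := Real.one_le_rpow hQ1 hδ0.le
  set Y := |(q : ℝ)| * Q ^ δ with hY
  have hY1 : 1 ≤ Y := by nlinarith
  have hYQ : Y ≤ Q ^ (1 + δ) := by rw [Real.rpow_add hQ0, Real.rpow_one, hY]; gcongr
  have hroot : (Y ^ ((n : ℝ)⁻¹)) ^ n = Y := Real.rpow_inv_natCast_pow (by linarith) hn.ne'
  set K := ⌊Y ^ ((n : ℝ)⁻¹)⌋₊
  have hKle : (K : ℝ) ≤ Y ^ ((n : ℝ)⁻¹) := Nat.floor_le (by positivity)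
  refine hQ q hq hqQ (fun _ => K) ?_ (fun j => ?_) fun k hk i => ?_
  · calc |(q : ℝ)| ≤ Y := by nlinarith
      _ = (Y ^ ((n : ℝ)⁻¹)) ^ n := hroot.symm
      _ < (K + 1 : ℝ) ^ n := by
          gcongr
          exact Nat.lt_floor_add_one _
      _ = _ := by simp
  · calc (K : ℝ) * distInt (q * x j) ≤ (Q ^ (1 + δ)) ^ ((n : ℝ)⁻¹) * Q ^ (-((1 + ε) / n)) := by
          refine mul_le_mul (hKle.trans ?_) (hcon j).le (distInt_nonneg _) (by positivity)
          gcongr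
      _ = Q ^ ((1 + δ) * (n : ℝ)⁻¹ + -((1 + ε) / n)) := by
          rw [← Real.rpow_mul hQ0.le, Real.rpow_add hQ0]
      _ ≤ Q ^ (-(3 * δ)) := by
          refine Real.rpow_le_rpow_of_exponent_le hQ1 ?_
          rw [hεδ]
          have e : (1 + δ) * (n : ℝ)⁻¹ + -((1 + 4 * n * δ) / n) = δ / n - 4 * δ := by
            field_simp; ring
          rw [e]
          have : δ / n ≤ δ := div_le_self hδ0.le hn'
          linarith
  · calc |(k i : ℝ)| ^ n ≤ (Y ^ ((n : ℝ)⁻¹)) ^ n := by gcongr; exact (hk i).trans hKle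
      _ = Y := hroot
      _ ≤ 2 * Y := by linarith

/-! ### From dual to simultaneous approximations -/

/-- If `∑ k i * x i` is close to an integer, then `x` has good simultaneous denominators. -/
lemma exists_sim_approx {n : ℕ} (x : Fin n → ℝ) (k : Fin n → ℤ) (i : Fin n) (hki : k i ≠ 0)
    (M : Fin n → ℕ) (hM : ∀ j, 0 < M j) (hb : (∏ j, (M j : ℝ)) * distInt (∑ j, k j * x j) ≤ 1)
    (hkM : ∀ j, |(k j : ℝ)| * M i ≤ |(k i : ℝ)| * M j) :
    ∃ q : ℤ, q ≠ 0 ∧ |(q : ℝ)| * M i ≤ |(k i : ℝ)| * ∏ j, (M j : ℝ) ∧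
      ∀ j, distInt (q * x j) ≤ n / M j := by
  classical
  set b := ∑ j, k j * x j with hbdef
  set k0 : ℤ := -round b with hk0
  have hMr (j) : (0 : ℝ) < M j := by exact_mod_cast hM j
  have hn : (1 : ℝ) ≤ n := by exact_mod_cast i.pos
  set R : ℕ := (k i).natAbs * ∏ j ∈ Finset.univ.erase i, M j with hR
  have habs : (((k i).natAbs : ℕ) : ℝ) = |(k i : ℝ)| := by
    rw [← Int.cast_abs, Int.abs_eq_natAbs]; simp
  have hki' : (k i : ℝ) ≠ 0 := by exact_mod_cast hki
  have hRM : (R : ℝ) * M i = |(k i : ℝ)| * ∏ j, (M j : ℝ) := by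
    rw [hR, ← Finset.mul_prod_erase _ _ (Finset.mem_univ i)]
    push_cast [habs]; ring
  -- There are `R` cells. Coordinate `i` does not record `a * x i` but the class of `k0 * a + ∑ k j
  -- * ⌊a * x j⌋` (over `j ≠ i`) modulo `k i`. Two multiples in one cell give an integer solution of
  -- `k0 * q + ∑ k j * p j = k i * e`, and `-e` serves as the integer near `q * x i`.
  obtain ⟨a, ha, c, hc, hac, h⟩ := exists_ne_abs_fract_sub_lt (Finset.range (R + 1))
    (fun a j => if j = i then
      ((k0 * a + ∑ j ∈ Finset.univ.erase i, k j * ⌊(a : ℝ) * x j⌋ : ℤ) : ℝ) / k i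
      else (a : ℝ) * x j)
    (Function.update M i (k i).natAbs) (fun j => by
      by_cases hj : j = i
      · subst hj; simpa using Int.natAbs_pos.2 hki
      · simpa [hj] using hM j) (by
      rw [Finset.prod_update_of_mem (Finset.mem_univ i), Finset.card_range,
        ← Finset.erase_eq]
      exact Nat.lt_succ_self _)
  wlog hlt : c < a generalizing a c
  · refine this c hc a ha hac.symm (fun j => ?_) (lt_of_le_of_ne (not_lt.1 hlt) hac)
    rw [abs_sub_comm]; exact h j
  set q : ℤ := (a : ℤ) - c with hq
  have hqr : (q : ℝ) = a - c := by simp [hq]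
  have hq0 : 0 < q := by omega
  have hqR : (q : ℝ) ≤ R := by
    have : q ≤ R := by have := Finset.mem_range.1 ha; omega
    exact_mod_cast this
  set p : Fin n → ℤ := fun j => ⌊(a : ℝ) * x j⌋ - ⌊(c : ℝ) * x j⌋ with hp
  have hpj {j} (hj : j ≠ i) : |q * x j - p j| < 1 / M j := by
    have := h j
    simp only [if_neg hj, Function.update_of_ne hj] at this
    refine lt_of_eq_of_lt ?_ this
    simp only [Int.fract, hqr, hp]; congr 1; push_cast; ring
  have h1 := h i
  simp only [if_pos, Function.update_self, habs] at h1
  obtain ⟨e, he⟩ := dvd_sub_of_abs_fract_sub_lt hki h1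
  have he' : (k0 * q + ∑ j ∈ Finset.univ.erase i, k j * p j : ℝ) = k i * e := by
    have : k0 * q + ∑ j ∈ Finset.univ.erase i, k j * p j = k i * e := by
      rw [← he, hq]; simp only [hp, mul_sub, Finset.sum_sub_distrib]; ring
    exact_mod_cast this
  have hqabs : |(q : ℝ)| = q := abs_of_pos (by exact_mod_cast hq0)
  refine ⟨q, hq0.ne', ?_, fun j => ?_⟩
  · rw [hqabs, ← hRM]
    have := hMr i
    gcongr
  by_cases hj : j = i
  swap
  · refine (distInt_le _ (p j)).trans ((hpj hj).le.trans ?_)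
    have := hMr j
    gcongr
  subst hj
  refine (distInt_le _ (-e)).trans ?_
  rw [le_div_iff₀ (hMr j)]
  have hkpos : 0 < |(k j : ℝ)| := abs_pos.2 hki'
  have hdist : distInt b = |b + k0| := by rw [distInt, hk0]; congr 1; push_cast; ring
  have e1 : k j * (q * x j - ((-e : ℤ) : ℝ)) =
      q * (b + k0) - ∑ l ∈ Finset.univ.erase j, k l * (q * x l - p l) := by
    have : b = k j * x j + ∑ l ∈ Finset.univ.erase j, k l * x l := by
      exact hbdef.trans
        (Finset.add_sum_erase _ (fun l => (k l : ℝ) * x l) (Finset.mem_univ j)).symm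
    simp only [mul_sub, Finset.sum_sub_distrib]
    have e2 : ∑ l ∈ Finset.univ.erase j, k l * (q * x l) =
        q * ∑ l ∈ Finset.univ.erase j, (k l : ℝ) * x l := by
      rw [Finset.mul_sum]; exact Finset.sum_congr rfl fun l _ => by ring
    rw [e2, this]
    push_cast at he' ⊢
    linarith
  -- The linear form contributes at most one `|k j|`, and so does each of the other `n - 1`
  -- coordinates; this is the `n` in the bound.
  have e3 : |(k j : ℝ)| * |q * x j - ((-e : ℤ) : ℝ)| * M j ≤ |(k j : ℝ)| * n := by
    rw [← abs_mul, e1]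
    have t1 : |q * (b + k0) - ∑ l ∈ Finset.univ.erase j, k l * (q * x l - p l)| ≤
        q * distInt b + ∑ l ∈ Finset.univ.erase j, |(k l : ℝ)| * (1 / M l) := by
      refine (abs_sub _ _).trans (add_le_add ?_ ?_)
      · rw [abs_mul, hqabs, hdist]
      · refine (Finset.abs_sum_le_sum_abs _ _).trans (Finset.sum_le_sum fun l hl => ?_)
        rw [abs_mul]
        exact mul_le_mul_of_nonneg_left (hpj (Finset.ne_of_mem_erase hl)).le (abs_nonneg _)
    have t2 : (∑ l ∈ Finset.univ.erase j, |(k l : ℝ)| * (1 / M l)) * M j ≤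
        (n - 1) * |(k j : ℝ)| := by
      rw [Finset.sum_mul]
      refine (Finset.sum_le_card_nsmul _ _ (|(k j : ℝ)|) fun l _ => ?_).trans_eq ?_
      · have := hMr l
        rw [mul_one_div, div_mul_eq_mul_div, div_le_iff₀ this]
        exact hkM l
      · rw [Finset.card_erase_of_mem (Finset.mem_univ j), nsmul_eq_mul, Finset.card_univ,
          Fintype.card_fin, Nat.cast_sub j.pos]
        simp
    have t3 : q * distInt b * M j ≤ |(k j : ℝ)| := by
      calc q * distInt b * M j ≤ R * distInt b * M j := by
            have := hMr j; have := distInt_nonneg b; gcongr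
        _ = (R * M j) * distInt b := by ring
        _ = |(k j : ℝ)| * ((∏ j, (M j : ℝ)) * distInt b) := by rw [hRM]; ring
        _ ≤ |(k j : ℝ)| * 1 := by gcongr
        _ = _ := mul_one _
    have := mul_le_mul_of_nonneg_right t1 (hMr j).le
    nlinarith
  rw [mul_assoc] at e3
  exact le_of_mul_le_mul_left e3 hkpos

/-- The height `⌊Q ^ δ⌋ ^ (n - 1) * P`, with `δ = ε / n`, is at most `Q ^ (1 + ε)`. Its power with
exponent `δ / (2 * (1 + ε))` is then at most `Q ^ (δ / 2)`, which is negligible against `⌊Q ^ δ⌋`.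
-/
lemma eventually_sim_bound (C : ℝ) {ε : ℝ} (hε : 0 < ε) {n : ℕ} (hn : 0 < n) :
    ∀ᶠ Q : ℝ in atTop, ∀ P : ℝ, 1 ≤ P → P ≤ Q →
      C * ((⌊Q ^ (ε / n)⌋₊ : ℝ) ^ (n - 1) * P) ^ (ε / n / (2 * (1 + ε))) < ⌊Q ^ (ε / n)⌋₊ := by
  have hn' : (1 : ℝ) ≤ n := by exact_mod_cast hn
  set δ := ε / n with hδ
  have hδ0 : 0 < δ := by positivity
  have hεδ : ε = n * δ := by rw [hδ]; field_simp
  filter_upwards [eventually_const_mul_rpow_lt (2 * max C 0) (show δ / 2 < δ by linarith),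
    eventually_ge_atTop 1] with Q hQ hQ1 P hP1 hPQ
  have hQ0 : 0 < Q := by linarith
  have hQδ : 1 ≤ Q ^ δ := Real.one_le_rpow hQ1 hδ0.le
  have hf1 := Nat.floor_le (zero_le_one.trans hQδ)
  have hf2 := Nat.lt_floor_add_one (Q ^ δ)
  have hf3 : (1 : ℝ) ≤ ⌊Q ^ δ⌋₊ := by
    exact_mod_cast (Nat.one_le_floor_iff _).2 hQδ
  have hbound : ((⌊Q ^ δ⌋₊ : ℝ) ^ (n - 1) * P) ≤ Q ^ (1 + ε) := by
    calc ((⌊Q ^ δ⌋₊ : ℝ) ^ (n - 1) * P) ≤ (Q ^ δ) ^ (n - 1) * Q := by gcongr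
      _ = Q ^ (δ * (n - 1) + 1) := by
          rw [Real.rpow_add hQ0, Real.rpow_one, Real.rpow_mul hQ0.le, ← Real.rpow_natCast,
            Nat.cast_sub hn, Nat.cast_one]
      _ ≤ Q ^ (1 + ε) := by
          refine Real.rpow_le_rpow_of_exponent_le hQ1 ?_
          rw [hεδ]; nlinarith
  have h2 : ((⌊Q ^ δ⌋₊ : ℝ) ^ (n - 1) * P) ^ (δ / (2 * (1 + ε))) ≤ Q ^ (δ / 2) := by
    calc _ ≤ (Q ^ (1 + ε)) ^ (δ / (2 * (1 + ε))) :=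
          Real.rpow_le_rpow (by positivity) hbound (by positivity)
      _ = Q ^ (δ / 2) := by rw [← Real.rpow_mul hQ0.le]; congr 1; field_simp
  have h3 : C * ((⌊Q ^ δ⌋₊ : ℝ) ^ (n - 1) * P) ^ (δ / (2 * (1 + ε))) ≤ max C 0 * Q ^ (δ / 2) := by
    refine mul_le_mul (le_max_left _ _) h2 (by positivity) (le_max_right _ _)
  linarith

/-- The parameters of the two transferences from simultaneous to dual approximation: `M` is a
large integer, and `P ≤ Q` bounds the size of `k`. -/
lemma eventually_sim_contradiction {n : ℕ} (hn : 2 ≤ n) {ε : ℝ} (hε : 0 < ε) {S : ℝ → Prop}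
    (h : ∀ᶠ Q : ℝ in atTop, S Q) :
    ∀ᶠ Q : ℝ in atTop, ∃ M : ℕ, 0 < M ∧ (∀ b : ℝ, 0 ≤ b → b < Q ^ (-(1 + ε)) → ∀ P : ℝ, 1 ≤ P →
      P ≤ Q → M ^ n * P * b ≤ 1) ∧ ∀ P : ℝ, 1 ≤ P → P ≤ Q → S (M ^ (n - 1) * P) ∧
        (n : ℝ) ^ n * (M ^ (n - 1) * P) ^ (ε / n / (2 * (1 + ε))) < M := by
  obtain ⟨Q₀, hQ₀⟩ := eventually_atTop.1 h
  have hn0 : 0 < n := by omega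
  have hδ0 : 0 < ε / n := by positivity
  filter_upwards [eventually_sim_bound ((n : ℝ) ^ n) hε hn0, eventually_ge_atTop 1,
    (tendsto_rpow_atTop hδ0).eventually_ge_atTop (Q₀ + 1)] with Q h1 hQ1 hQ2
  have hQ0 : 0 < Q := by linarith
  have hQδ : 1 ≤ Q ^ (ε / n) := Real.one_le_rpow hQ1 hδ0.le
  have hf1 := Nat.floor_le (zero_le_one.trans hQδ)
  have hf2 := Nat.lt_floor_add_one (Q ^ (ε / n))
  have hf3 : 1 ≤ ⌊Q ^ (ε / n)⌋₊ := (Nat.one_le_floor_iff _).2 hQδ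
  have hf3' : (1 : ℝ) ≤ ⌊Q ^ (ε / n)⌋₊ := by exact_mod_cast hf3
  refine ⟨⌊Q ^ (ε / n)⌋₊, hf3, fun b hb0 hb P hP1 hPQ => ?_, fun P hP1 hPQ =>
    ⟨hQ₀ _ ?_, h1 P hP1 hPQ⟩⟩
  · calc (⌊Q ^ (ε / n)⌋₊ : ℝ) ^ n * P * b ≤ (Q ^ (ε / n)) ^ n * Q * Q ^ (-(1 + ε)) := by gcongr
      _ = Q ^ (ε / n * n + 1 + -(1 + ε)) := by
          rw [Real.rpow_add hQ0, Real.rpow_add hQ0, Real.rpow_one, Real.rpow_mul hQ0.le,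
            Real.rpow_natCast]
      _ = 1 := by
          rw [div_mul_cancel₀ _ (by positivity), add_comm ε 1, add_neg_cancel, Real.rpow_zero]
  -- Here `n ≥ 2` matters: `M ≤ M ^ (n - 1)`, so the height passes `Q₀` even for `P = 1`. For `n =
  -- 1` rows and columns coincide.
  · have h4 : (⌊Q ^ (ε / n)⌋₊ : ℝ) ≤ (⌊Q ^ (ε / n)⌋₊ : ℝ) ^ (n - 1) :=
      le_self_pow₀ hf3' (by omega)
    nlinarith

/-- With cells `M * max 1 |k j|`, the pigeonhole gives `|q| ≤ Z = M ^ (n - 1) * P` and `∏ ‖q x j‖ ≤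
n ^ n / (M * Z)`. The gain `1 / M` exceeds what exponent 1 allows. -/
lemma MulSimUpper.mulDualUpper {n : ℕ} (hn : 2 ≤ n) {x : Fin n → ℝ} (h : MulSimUpper x 0) :
    MulDualUpper x := by
  intro ε hε
  have hn0 : 0 < n := by omega
  filter_upwards [eventually_sim_contradiction hn hε (h (ε / n / (2 * (1 + ε))) (by positivity))]
    with Q hQ k hk hkQ
  by_contra! hcon
  obtain ⟨M, hM, hb, hS⟩ := hQ
  have hMr : (0 : ℝ) < M := by exact_mod_cast hM
  obtain ⟨i, hi⟩ := Function.ne_iff.1 hk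
  have hi' : (1 : ℝ) ≤ |(k i : ℝ)| := by exact_mod_cast Int.one_le_abs hi
  set P := ∏ i, max 1 |(k i : ℝ)| with hP
  have hP1 : 1 ≤ P := by
    have : ∏ _i : Fin n, (1 : ℝ) ≤ P :=
      Finset.prod_le_prod (fun _ _ => by simp) fun _ _ => le_max_left _ _
    simpa using this
  have hmax (j) : ((max 1 (k j).natAbs : ℕ) : ℝ) = max 1 |(k j : ℝ)| := by
    rw [Nat.cast_max, ← Int.cast_abs, Int.abs_eq_natAbs]; simp
  have hprod : ∏ j, ((M * max 1 (k j).natAbs : ℕ) : ℝ) = M ^ n * P := by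
    simp only [Nat.cast_mul, hmax, Finset.prod_mul_distrib, hP]; simp
  obtain ⟨q, hq0, hq1, hq2⟩ := exists_sim_approx x k i hi (fun j => M * max 1 (k j).natAbs)
    (fun j => by positivity) (by rw [hprod]; exact hb _ (distInt_nonneg _) hcon P hP1 hkQ)
    (fun j => by
      rw [Nat.cast_mul, Nat.cast_mul, hmax, hmax, max_eq_right hi']
      have := le_max_right 1 |(k j : ℝ)|
      have : 0 < M * |(k i : ℝ)| := by positivity
      nlinarith)
  obtain ⟨hS1, hS2⟩ := hS P hP1 hkQ
  have hpow : (M : ℝ) ^ n = M ^ (n - 1) * M := by rw [← pow_succ]; congr 1; omega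
  rw [hprod, Nat.cast_mul, hmax, max_eq_right hi', hpow] at hq1
  have hqQ : |(q : ℝ)| ≤ M ^ (n - 1) * P := by
    have : 0 < M * |(k i : ℝ)| := by positivity
    nlinarith
  have h1 := hS1 q hq0 hqQ
  simp only [Pi.zero_apply, add_zero] at h1
  set Z := (M : ℝ) ^ (n - 1) * P with hZ
  have hZ0 : 0 < Z := by positivity
  have h2 : ∏ j, distInt (q * x j) ≤ n ^ n / (M * Z) := by
    calc ∏ j, distInt (q * x j) ≤ ∏ j, ((n : ℝ) / ((M * max 1 (k j).natAbs : ℕ) : ℝ)) :=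
          Finset.prod_le_prod (fun _ _ => distInt_nonneg _) fun j _ => hq2 j
      _ = n ^ n / (M * Z) := by
          rw [Finset.prod_div_distrib, hprod, hpow, hZ]; simp; ring
  have h3 := h1.trans h2
  rw [Real.rpow_neg hZ0.le, Real.rpow_add hZ0, Real.rpow_one, le_div_iff₀ (by positivity),
    inv_mul_eq_div, div_le_iff₀ (by positivity)] at h3
  have : M * Z < M * Z := by
    calc M * Z ≤ n ^ n * Z ^ (ε / n / (2 * (1 + ε))) * Z := by linarith
      _ < M * Z := by gcongr
  exact lt_irrefl _ this

/-- As in the multiplicative case, but with equal cells `M * H`, where `H` is the largest `|k j|`;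
choosing `i` to attain it makes `exists_sim_approx` applicable. -/
lemma SimUpper.dualUpper {n : ℕ} (hn : 2 ≤ n) {x : Fin n → ℝ} (h : SimUpper x 0) :
    DualUpper x := by
  intro ε hε
  have hn0 : 0 < n := by omega
  filter_upwards [eventually_sim_contradiction hn hε (h (ε / n / (2 * (1 + ε))) (by positivity)),
    eventually_ge_atTop 1] with Q hQ hQ1 k hk hkQ
  by_contra! hcon
  obtain ⟨M, hM, hb, hS⟩ := hQ
  have hMr : (0 : ℝ) < M := by exact_mod_cast hM
  obtain ⟨i0, hi0⟩ := Function.ne_iff.1 hk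
  obtain ⟨i, -, hi⟩ := Finset.exists_max_image Finset.univ (fun i => |(k i : ℝ)|)
    ⟨i0, Finset.mem_univ _⟩
  have hmax (j) : |(k j : ℝ)| ≤ |(k i : ℝ)| := hi j (Finset.mem_univ j)
  have hi0' : (1 : ℝ) ≤ |(k i0 : ℝ)| := by exact_mod_cast Int.one_le_abs hi0
  have hi' : (1 : ℝ) ≤ |(k i : ℝ)| := hi0'.trans (hmax i0)
  have hki : k i ≠ 0 := by
    intro h0; rw [h0] at hi'; norm_num at hi'
  have habs : (((k i).natAbs : ℕ) : ℝ) = |(k i : ℝ)| := by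
    rw [← Int.cast_abs, Int.abs_eq_natAbs]; simp
  set H := (k i).natAbs with hH
  have hH1 : (1 : ℝ) ≤ H := by rw [habs]; exact hi'
  set P : ℝ := (H : ℝ) ^ n with hP
  have hP1 : 1 ≤ P := one_le_pow₀ hH1
  have hPQ : P ≤ Q := by rw [hP, habs]; exact hkQ i
  have hprod : ∏ _j : Fin n, ((M * H : ℕ) : ℝ) = M ^ n * P := by simp [mul_pow, hP]
  have hHn : 0 < H := by rw [hH]; exact Int.natAbs_pos.2 hki
  obtain ⟨q, hq0, hq1, hq2⟩ := exists_sim_approx x k i hki (fun _ => M * H)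
    (fun j => by positivity) (by rw [hprod]; exact hb _ (distInt_nonneg _) hcon P hP1 hPQ)
    (fun j => by have := hmax j; gcongr)
  obtain ⟨hS1, hS2⟩ := hS P hP1 hPQ
  have hpow : (M : ℝ) ^ n = M ^ (n - 1) * M := by rw [← pow_succ]; congr 1; omega
  rw [hprod, Nat.cast_mul, habs, hpow] at hq1
  have hqQ : |(q : ℝ)| ≤ M ^ (n - 1) * P := by
    have : 0 < M * |(k i : ℝ)| := by positivity
    nlinarith
  obtain ⟨j, h1⟩ := hS1 q hq0 hqQ
  simp only [Pi.zero_apply, add_zero] at h1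
  set Z := (M : ℝ) ^ (n - 1) * P with hZ
  have hZ0 : 0 < Z := by positivity
  have h3 : (Z ^ (-((1 + ε / n / (2 * (1 + ε))) / n))) ^ n ≤ (n / ((M * H : ℕ) : ℝ)) ^ n := by
    gcongr; exact h1.trans (hq2 j)
  rw [← Real.rpow_natCast, ← Real.rpow_mul hZ0.le, ← neg_div,
    div_mul_cancel₀ _ (by positivity : (n : ℝ) ≠ 0), div_pow, Nat.cast_mul, mul_pow, hpow,
    show (M : ℝ) ^ (n - 1) * M * H ^ n = M * Z by rw [hZ, hP]; ring,
    Real.rpow_neg hZ0.le, Real.rpow_add hZ0, Real.rpow_one, le_div_iff₀ (by positivity),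
    inv_mul_eq_div, div_le_iff₀ (by positivity)] at h3
  have : M * Z < M * Z := by
    calc M * Z ≤ n ^ n * Z ^ (ε / n / (2 * (1 + ε))) * Z := by linarith
      _ < M * Z := by gcongr
  exact lt_irrefl _ this

lemma col_eq_row (x : EuclideanSpace ℝ (Fin 1)) : col x = row x := by
  ext i j
  simp [col, row, Subsingleton.elim i j]

/-- Khintchine's transference principle, for the bound `w ≤ 1`. -/
lemma exponent_col_le_one_iff_row {n : ℕ} (hn : 0 < n) (x : EuclideanSpace ℝ (Fin n)) :
    exponent (col x) 0 ≤ 1 ↔ exponent (row x) 0 ≤ 1 := by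
  obtain rfl | hn2 := (Nat.succ_le_iff.2 hn).eq_or_lt
  · rw [col_eq_row]
  · rw [exponent_col_le_one_iff hn, exponent_row_le_one_iff hn]
    exact ⟨fun h => h.dualUpper hn2, fun h => h.simUpper hn⟩

/-- Multiplicative transference, for the bound `w^× ≤ 1`. -/
lemma mulExponent_col_le_one_iff_row {n : ℕ} (hn : 0 < n) (x : EuclideanSpace ℝ (Fin n)) :
    mulExponent (col x) 0 ≤ 1 ↔ mulExponent (row x) 0 ≤ 1 := by
  obtain rfl | hn2 := (Nat.succ_le_iff.2 hn).eq_or_lt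
  · rw [col_eq_row]
  · rw [mulExponent_col_le_one_iff, mulExponent_row_le_one_iff]
    exact ⟨fun h => h.mulDualUpper hn2, fun h => h.mulSimUpper hn⟩

/-! ### Lower bounds for the exponents -/

/-- Dirichlet's theorem for one linear form. -/
lemma one_le_exponent_row {n : ℕ} (hn : 0 < n) (x : EuclideanSpace ℝ (Fin n)) :
    1 ≤ exponent (row x) 0 := by
  rw [exponent_eq_exponentOf]
  refine one_le_exponentOf fun w hw0 hw1 => frequently_atTop.2 fun B => ?_
  set K : ℕ := max 1 ⌈B⌉₊ with hK
  have hK1 : 1 ≤ K := le_max_left _ _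
  have hK1' : (1 : ℝ) ≤ K := by exact_mod_cast hK1
  have hKB : B ≤ K := (Nat.le_ceil B).trans (by exact_mod_cast le_max_right _ _)
  have hKn : (1 : ℝ) ≤ (K : ℝ) ^ n := one_le_pow₀ hK1'
  obtain ⟨a, ha, b, hb, hab, h⟩ := exists_ne_abs_fract_sub_lt
    (Fintype.piFinset fun _ : Fin n => Finset.range (K + 1))
    (fun a (_ : Unit) => ∑ j, (a j : ℝ) * x j) (fun _ => K ^ n) (fun _ => by positivity) (by
      simp only [Finset.univ_unique, Finset.prod_const, Finset.card_singleton, pow_one,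
        Fintype.card_piFinset, Finset.card_range, Finset.card_univ, Fintype.card_fin]
      exact Nat.pow_lt_pow_left (Nat.lt_succ_self K) hn.ne')
  refine ⟨(K : ℝ) ^ n, hKB.trans (le_self_pow₀ hK1' hn.ne'), fun j => (a j : ℤ) - b j, ?_, ?_, ?_⟩
  · intro h0
    exact hab (funext fun j => by have := congrFun h0 j; simp only [Pi.zero_apply] at this; omega)
  · rw [norm_pow_lt_rpow_iff one_pos _ (by positivity)]
    intro j
    rw [abs_centered, linForms_row]
    have h1 := (distInt_sub_le_of_fract _ _).trans_lt (h ())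
    calc distInt (∑ i, (((a i : ℤ) - b i : ℤ) : ℝ) * x i)
        = distInt (∑ j, (a j : ℝ) * x j - ∑ j, (b j : ℝ) * x j) := by
          rw [← Finset.sum_sub_distrib]; push_cast; simp only [sub_mul]
      _ < 1 / ((K ^ n : ℕ) : ℝ) := h1
      _ = ((K : ℝ) ^ n) ^ (-1 : ℝ) := by rw [Real.rpow_neg_one, one_div]; push_cast; rfl
      _ ≤ _ := by
        refine Real.rpow_le_rpow_of_exponent_le hKn ?_
        simp only [Nat.cast_one, div_one]; linarith
  · gcongr
    refine (pi_norm_le_iff_of_nonneg (by positivity)).2 fun j => ?_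
    have h1 := Finset.mem_range.1 (Fintype.mem_piFinset.1 ha j)
    have h2 := Finset.mem_range.1 (Fintype.mem_piFinset.1 hb j)
    have : |(a j : ℤ) - b j| ≤ K := by rw [abs_le]; omega
    rw [Real.norm_eq_abs]
    exact_mod_cast this

lemma one_le_exponent_col_of {n : ℕ} (hn : 0 < n) (x : EuclideanSpace ℝ (Fin n)) (θ : Fin n → ℝ)
    (h : ∀ w : ℝ, 0 < w → w < 1 → ∀ B : ℝ, ∃ Q : ℝ, B ≤ Q ∧ 0 < Q ∧ ∃ q : ℤ, q ≠ 0 ∧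
      |(q : ℝ)| ≤ Q ∧ ∀ j, distInt (q * x j + θ j) < Q ^ (-(w / n))) :
    1 ≤ exponent (col x) θ := by
  rw [exponent_eq_exponentOf]
  refine one_le_exponentOf fun w hw0 hw1 => frequently_atTop.2 fun B => ?_
  obtain ⟨Q, hBQ, hQ, q, hq, hqQ, hd⟩ := h w hw0 hw1 B
  refine ⟨Q, hBQ, fun _ => q, (fin_one_ne_zero_iff _).2 hq, ?_, ?_⟩
  · rw [norm_pow_lt_rpow_iff hn _ hQ]
    intro j
    rw [abs_centered, linForms_col]
    exact hd j
  · rw [norm_intCast_fin_one]; exact hqQ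

/-- Dirichlet's theorem on simultaneous approximation. -/
lemma one_le_exponent_col_of_int {n : ℕ} (hn : 0 < n) (x : EuclideanSpace ℝ (Fin n))
    (θ : Fin n → ℝ) (hθ : ∀ j, distInt (θ j) = 0) : 1 ≤ exponent (col x) θ := by
  refine one_le_exponent_col_of hn x θ fun w hw0 hw1 B => ?_
  set G : ℕ := max 1 ⌈B⌉₊ with hG
  have hG1 : 1 ≤ G := le_max_left _ _
  have hG1' : (1 : ℝ) ≤ G := by exact_mod_cast hG1
  have hGB : B ≤ G := (Nat.le_ceil B).trans (by exact_mod_cast le_max_right _ _)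
  have hGn : (1 : ℝ) ≤ (G : ℝ) ^ n := one_le_pow₀ hG1'
  obtain ⟨a, ha, b, hb, hab, h⟩ := exists_ne_abs_fract_sub_lt (Finset.range (G ^ n + 1))
    (fun a (j : Fin n) => (a : ℝ) * x j) (fun _ => G) (fun _ => hG1) (by simp)
  refine ⟨(G : ℝ) ^ n, hGB.trans (le_self_pow₀ hG1' hn.ne'), by positivity, (a : ℤ) - b, ?_, ?_, ?_⟩
  · intro h0; exact hab (by omega)
  · have h1 := Finset.mem_range.1 ha
    have h2 := Finset.mem_range.1 hb
    have : |(a : ℤ) - b| ≤ (G ^ n : ℕ) := by rw [abs_le]; omega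
    exact_mod_cast this
  · intro j
    calc distInt ((((a : ℤ) - b : ℤ) : ℝ) * x j + θ j)
        ≤ distInt ((a : ℝ) * x j - b * x j) + distInt (θ j) := by
          push_cast; rw [sub_mul]; exact distInt_add_le _ _
      _ = distInt ((a : ℝ) * x j - b * x j) := by rw [hθ, add_zero]
      _ < 1 / (G : ℝ) := (distInt_sub_le_of_fract _ _).trans_lt (h j)
      _ = ((G : ℝ) ^ n) ^ (-(1 / (n : ℝ))) := by
          rw [Real.rpow_neg (by positivity), one_div (n : ℝ),
            Real.pow_rpow_inv_natCast (by positivity) hn.ne', one_div]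
      _ ≤ _ := Real.rpow_le_rpow_of_exponent_le hGn (by gcongr)

/-- If the multiples `q x`, `0 < |q| ≤ N`, stay away from the integer points, then the multiples
`q x` with `|q| ≤ S N` come close to any given point. -/
lemma exists_inhom_approx {n : ℕ} (x t : Fin n → ℝ) (N G S : ℕ) (hG : 0 < G)
    (h : ∀ q : ℤ, q ≠ 0 → |(q : ℝ)| ≤ N → ∃ j, 1 / (G : ℝ) ≤ distInt (q * x j))
    (hS : G ^ n < (S + 1) * (N + 1)) :
    ∃ q : ℤ, |(q : ℝ)| ≤ S * N ∧ ∀ j, distInt (q * x j - t j) ≤ S * (2 / G) := by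
  have hGr : (0 : ℝ) < G := by exact_mod_cast hG
  obtain ⟨L, hL0, hL⟩ : ∃ L : ℕ, 0 < L ∧ ∀ j, |t j| * G ≤ L := by
    refine ⟨⌈‖t‖ * G⌉₊ + 1, Nat.succ_pos _, fun j => ?_⟩
    have h1 : |t j| * G ≤ ‖t‖ * G := by gcongr; exact norm_le_pi_norm t j
    have h2 := Nat.le_ceil (‖t‖ * G)
    push_cast; linarith
  have hLr : (0 : ℝ) < L := by exact_mod_cast hL0
  -- A walk from `0` to `t` in `L` steps, each changing every coordinate by at most `1 / G`.
  set y : ℕ → Fin n → ℝ := fun k j => (k : ℝ) / L * t j with hy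
  let Rel (k l : ℕ) : Prop :=
    ∃ q : ℤ, |(q : ℝ)| ≤ N ∧ ∀ j, distInt (q * x j - (y l j - y k j)) < 1 / G
  have hrefl (k) : Rel k k := ⟨0, by simp, fun j => by simpa [distInt] using hGr⟩
  have hstep (k j) : |y (k + 1) j - y k j| ≤ 1 / G := by
    have : y (k + 1) j - y k j = t j / L := by simp only [hy]; push_cast; ring
    rw [this, abs_div, abs_of_pos hLr, div_le_div_iff₀ hLr hGr, one_mul]
    exact hL j
  -- Otherwise more than `G ^ n` points `q x + y a` with `0 ≤ q ≤ N`, `a ∈ F` share `G ^ n` cells. A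
  -- collision with equal `a` contradicts the separation of the multiples, and one with `a < b`
  -- relates `a` to `b`.
  have hpack (F : Finset ℕ) (hF : ∀ a ∈ F, ∀ b ∈ F, a < b → ¬ Rel a b) : F.card ≤ S := by
    by_contra! hcard
    obtain ⟨⟨a, q⟩, ha, ⟨b, q'⟩, hb, hne, hd⟩ := exists_ne_abs_fract_sub_lt
      (F ×ˢ Finset.range (N + 1)) (fun z j => (z.2 : ℝ) * x j + y z.1 j) (fun _ => G)
      (fun _ => hG) (by
        simp only [Finset.prod_const, Finset.card_univ, Fintype.card_fin, Finset.card_product,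
          Finset.card_range]
        exact hS.trans_le (Nat.mul_le_mul_right _ hcard))
    wlog hab : a ≤ b generalizing a b q q'
    · exact this b q' hb a q ha hne.symm (fun j => by rw [abs_sub_comm]; exact hd j)
        (not_le.1 hab).le
    simp only [Finset.mem_product, Finset.mem_range] at ha hb
    have hq : |(((q : ℤ) - q' : ℤ) : ℝ)| ≤ N := by
      have : |(q : ℤ) - q'| ≤ N := by rw [abs_le]; omega
      exact_mod_cast this
    have hd' (j) : distInt ((((q : ℤ) - q' : ℤ) : ℝ) * x j - (y b j - y a j)) < 1 / G := by
      refine lt_of_eq_of_lt ?_ ((distInt_sub_le_of_fract _ _).trans_lt (hd j))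
      congr 1; push_cast; ring
    rcases hab.eq_or_lt with rfl | hlt
    · obtain ⟨j, hj⟩ := h ((q : ℤ) - q') (by
        intro h0; exact hne (by rw [show q = q' by omega])) hq
      have := hd' j
      rw [sub_self, sub_zero] at this
      linarith
    · exact hF a ha.1 b hb.1 hlt ⟨_, hq, hd'⟩
  -- Greedy jumps: from `k` to the last related index `k'`, then one step to `k' + 1`. No later
  -- index is related to `k`, so the largest unrelated family shrinks by one. A jump and a step cost
  -- `N` in `q` and `2 / G` in distance.
  have main : ∀ s k : ℕ, k ≤ L →
      (∀ F : Finset ℕ, (∀ a ∈ F, k ≤ a ∧ a ≤ L) → (∀ a ∈ F, ∀ b ∈ F, a < b → ¬ Rel a b) →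
        F.card ≤ s) →
      ∃ q : ℤ, |(q : ℝ)| ≤ s * N ∧ ∀ j, distInt (q * x j - (y L j - y k j)) ≤ s * (2 / G) := by
    intro s
    induction s with
    | zero =>
      intro k hk hF
      have := hF {k} (by simpa using hk) (by simp)
      simp at this
    | succ s ih =>
      intro k hk hF
      classical
      obtain ⟨k', hk', hmax⟩ := Finset.exists_max_image
        ((Finset.Icc k L).filter fun l => Rel k l) id
        ⟨k, Finset.mem_filter.2 ⟨Finset.mem_Icc.2 ⟨le_rfl, hk⟩, hrefl k⟩⟩
      rw [Finset.mem_filter, Finset.mem_Icc] at hk'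
      obtain ⟨⟨hkk', hk'L⟩, q1, hq1, hd1⟩ := hk'
      have hs : (0 : ℝ) ≤ s := Nat.cast_nonneg s
      have hNn : (0 : ℝ) ≤ N := Nat.cast_nonneg N
      have hG' : 2 / (G : ℝ) = 1 / G + 1 / G := by ring
      have hGi : 0 < 1 / (G : ℝ) := by positivity
      rcases hk'L.eq_or_lt with rfl | hlt
      · refine ⟨q1, ?_, fun j => ?_⟩
        · push_cast; nlinarith
        · have := hd1 j
          push_cast; rw [hG']; nlinarith
      · obtain ⟨q2, hq2, hd2⟩ := ih (k' + 1) hlt fun F hF1 hF2 => by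
          have hkF : k ∉ F := fun hkF => by have := (hF1 k hkF).1; omega
          have := hF (insert k F) (by
            intro a ha
            rcases Finset.mem_insert.1 ha with rfl | ha
            · exact ⟨le_rfl, hk⟩
            · have := hF1 a ha; omega) (by
            have hnot : ∀ b ∈ F, ¬ Rel k b := fun b hb hr => by
              have h1 := hF1 b hb
              have h2 := hmax b (Finset.mem_filter.2 ⟨Finset.mem_Icc.2 (by omega), hr⟩)
              simp only [id] at h2
              omega
            intro a ha b hb hab
            rcases Finset.mem_insert.1 ha with rfl | haF
            · rcases Finset.mem_insert.1 hb with rfl | hbF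
              · omega
              · exact hnot b hbF
            · rcases Finset.mem_insert.1 hb with rfl | hbF
              · have := hF1 a haF; omega
              · exact hF2 a haF b hbF hab)
          rw [Finset.card_insert_of_notMem hkF] at this
          omega
        refine ⟨q1 + q2, ?_, fun j => ?_⟩
        · push_cast
          refine (abs_add_le _ _).trans ?_
          linarith
        · have e : ((q1 + q2 : ℤ) : ℝ) * x j - (y L j - y k j) =
              (q1 * x j - (y k' j - y k j)) + (q2 * x j - (y L j - y (k' + 1) j)) -
                (y (k' + 1) j - y k' j) := by push_cast; ring
          rw [e]
          have h1 := distInt_sub_le ((q1 * x j - (y k' j - y k j)) +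
            (q2 * x j - (y L j - y (k' + 1) j))) (y (k' + 1) j - y k' j)
          have h2 := distInt_add_le (q1 * x j - (y k' j - y k j))
            (q2 * x j - (y L j - y (k' + 1) j))
          have h3 := (distInt_le_abs (y (k' + 1) j - y k' j)).trans (hstep k' j)
          have h4 := hd1 j
          have h5 := hd2 j
          push_cast
          rw [add_mul, one_mul, hG']
          rw [hG'] at h5
          linarith
  obtain ⟨q, hq, hd⟩ := main S 0 (Nat.zero_le _) fun F _ hF => hpack F hF
  refine ⟨q, hq, fun j => ?_⟩
  have := hd j
  have e : y L j - y 0 j = t j := by simp [hy, hLr.ne']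
  rwa [e] at this

/-- The inhomogeneous exponent of `x` is at least `1` if its homogeneous exponent is at most
`1`. -/
lemma SimUpper.one_le_exponent_col {n : ℕ} (hn : 0 < n) {x : EuclideanSpace ℝ (Fin n)}
    (hx : SimUpper x.ofLp 0) (θ : Fin n → ℝ) : 1 ≤ exponent (col x) θ := by
  by_cases hθ : ∀ j, distInt (θ j) = 0
  · exact one_le_exponent_col_of_int hn x θ hθ
  push Not at hθ
  obtain ⟨j₀, hj₀⟩ := hθ
  have hc : 0 < distInt (θ j₀) := lt_of_le_of_ne (distInt_nonneg _) hj₀.symm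
  have hn' : (1 : ℝ) ≤ n := by exact_mod_cast hn
  refine one_le_exponent_col_of hn x θ fun w hw0 hw1 B => ?_
  -- Then `hexp` amounts to `ε < (1 + ε) * ε`: with `G ≈ N ^ ((1 + ε) / n)` and `S ≲ N ^ ε`, the
  -- error `2 * S / G` beats `Q ^ (-w / n)` at height `Q ≈ N ^ (1 + ε)`.
  set ε := (1 - w) / n with hε
  have hε0 : 0 < ε := div_pos (by linarith) (by linarith)
  have hexp : ε - (1 + ε) / n < -((1 + ε) * w / n) := by
    have : (1 - w) / n < (1 + ε) * (1 - w) / n := by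
      gcongr; nlinarith
    have e : (1 + ε) * (1 - w) / n = (1 + ε) / n - (1 + ε) * w / n := by ring
    rw [e, ← hε] at this
    linarith
  have hev := (((hx ε hε0).and (eventually_const_mul_rpow_lt (2 ^ (n + 2)) hexp)).and
    ((eventually_const_mul_rpow_le (1 / distInt (θ j₀)) (show -(w / n) < 0 by
      have : 0 < w / n := by positivity
      linarith)).and (eventually_ge_atTop (max 1 B))))
  obtain ⟨N, ⟨hN1, hN2⟩, hN3, hN4⟩ := (tendsto_natCast_atTop_atTop.eventually hev).exists
  have hN : (1 : ℝ) ≤ N := (le_max_left _ _).trans hN4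
  have hNB : B ≤ N := (le_max_right _ _).trans hN4
  have hN0 : (0 : ℝ) < N := by linarith
  set G : ℕ := ⌈(N : ℝ) ^ ((1 + ε) / n)⌉₊ with hG
  have hpow1 : 1 ≤ (N : ℝ) ^ ((1 + ε) / n) := Real.one_le_rpow hN (by positivity)
  have hG1 : (N : ℝ) ^ ((1 + ε) / n) ≤ G := Nat.le_ceil _
  have hG2 : (G : ℝ) ≤ 2 * (N : ℝ) ^ ((1 + ε) / n) := by
    have := Nat.ceil_lt_add_one (zero_le_one.trans hpow1)
    linarith
  have hG0 : (0 : ℝ) < G := by linarith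
  have hGinv : 1 / (G : ℝ) ≤ (N : ℝ) ^ (-((1 + ε) / n)) := by
    rw [Real.rpow_neg hN0.le, ← one_div]
    exact one_div_le_one_div_of_le (by linarith) hG1
  set S : ℕ := G ^ n / (N + 1) with hS
  obtain ⟨q, hq, hd⟩ := exists_inhom_approx x.ofLp (-θ) N G S (by exact_mod_cast hG0)
    (fun q hq hqN => by
      obtain ⟨j, hj⟩ := hN1 q hq hqN
      simp only [Pi.zero_apply, add_zero] at hj
      exact ⟨j, hGinv.trans hj⟩)
    (by rw [hS]; exact Nat.lt_mul_of_div_lt (Nat.lt_succ_self _) (Nat.succ_pos _))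
  have hSN : (S : ℝ) ≤ 2 ^ n * (N : ℝ) ^ ε := by
    have h1 : (S : ℝ) ≤ (G : ℝ) ^ n / (N + 1) := by
      have := @Nat.cast_div_le ℝ _ _ _ (G ^ n) (N + 1)
      push_cast at this; exact this
    calc (S : ℝ) ≤ (G : ℝ) ^ n / (N + 1) := h1
      _ ≤ (2 * (N : ℝ) ^ ((1 + ε) / n)) ^ n / N := by gcongr; linarith
      _ = 2 ^ n * (N : ℝ) ^ ε := by
        rw [mul_pow, ← Real.rpow_natCast ((N : ℝ) ^ _), ← Real.rpow_mul hN0.le,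
          div_mul_cancel₀ _ (by positivity), Real.rpow_add hN0, Real.rpow_one]
        field_simp
  set Q : ℝ := 2 ^ n * (N : ℝ) ^ (1 + ε) with hQ
  have h2n : (1 : ℝ) ≤ 2 ^ n := one_le_pow₀ (by norm_num)
  have hNQ : (N : ℝ) ≤ Q := by
    have : (N : ℝ) ^ (1 : ℝ) ≤ (N : ℝ) ^ (1 + ε) :=
      Real.rpow_le_rpow_of_exponent_le hN (by linarith)
    rw [Real.rpow_one] at this
    nlinarith
  have hQ0 : 0 < Q := by linarith
  have hbound : (S : ℝ) * (2 / G) < Q ^ (-(w / n)) := by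
    have e1 : (S : ℝ) * (2 / G) ≤ 2 ^ (n + 1) * (N : ℝ) ^ (ε - (1 + ε) / n) := by
      calc (S : ℝ) * (2 / G) = S * 2 * (1 / G) := by ring
        _ ≤ 2 ^ n * (N : ℝ) ^ ε * 2 * (N : ℝ) ^ (-((1 + ε) / n)) := by gcongr
        _ = _ := by rw [sub_eq_add_neg, Real.rpow_add hN0, pow_succ]; ring
    have e2 : 2⁻¹ * (N : ℝ) ^ (-((1 + ε) * w / n)) ≤ Q ^ (-(w / n)) := by
      rw [hQ, Real.mul_rpow (by positivity) (by positivity), ← Real.rpow_mul hN0.le,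
        ← Real.rpow_natCast, ← Real.rpow_mul (by norm_num)]
      have e3 : (1 + ε) * -(w / n) = -((1 + ε) * w / n) := by ring
      have e4 : (n : ℝ) * -(w / n) = -w := by field_simp
      rw [e3, e4]
      gcongr
      rw [← Real.rpow_neg_one]
      exact Real.rpow_le_rpow_of_exponent_le (by norm_num) (by linarith)
    rw [pow_succ] at hN2
    linarith
  refine ⟨Q, hNB.trans hNQ, hQ0, q, ?_, ?_, fun j => ?_⟩
  -- For `q = 0` the error bound would force `‖θ j₀‖ < N ^ (-w / n)`, which the choice of `N`
  -- excludes.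
  · rintro rfl
    have h1 := (hd j₀).trans_lt hbound
    simp only [Int.cast_zero, zero_mul, zero_sub, Pi.neg_apply, neg_neg] at h1
    have h2 : Q ^ (-(w / n)) ≤ (N : ℝ) ^ (-(w / n)) :=
      Real.rpow_le_rpow_of_nonpos hN0 hNQ (by
        have : 0 < w / n := by positivity
        linarith)
    rw [Real.rpow_zero, one_div, inv_mul_le_iff₀ hc, mul_one] at hN3
    linarith
  · calc |(q : ℝ)| ≤ S * N := hq
      _ ≤ 2 ^ n * (N : ℝ) ^ ε * N := by gcongr
      _ = Q := by rw [hQ, Real.rpow_add hN0, Real.rpow_one]; ring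
  · have := (hd j).trans_lt hbound
    rwa [Pi.neg_apply, sub_neg_eq_add] at this

/-! ### Measure-theoretic lemmas -/

section Measure

variable {E : Type*} [NormedAddCommGroup E] [MeasurableSpace E] [BorelSpace E]

/-- A set that is disjoint from many of its translates in one direction has small measure. -/
lemma nsmul_measure_le_of_translates [NormedSpace ℝ E] (μ : Measure E) [μ.IsAddRightInvariant]
    {A : Set E} (hA : MeasurableSet A) {v e : E} {r τ : ℝ} (hAr : A ⊆ Metric.closedBall v r)
    (hτ : 0 < τ) (hsep : ∀ u ∈ A, ∀ s : ℝ, u + s • e ∈ A → |s| < τ) {N : ℕ}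
    (hN : N * (τ * ‖e‖) ≤ r) : N * μ A ≤ μ (Metric.closedBall v (2 * r)) := by
  set T : ℕ → Set E := fun i => (fun u => u + (-((i : ℝ) * τ)) • e) ⁻¹' A with hT
  have hTm (i) : MeasurableSet (T i) := (measurable_add_const _) hA
  have hTμ (i) : μ (T i) = μ A := measure_preimage_add_right μ _ A
  have hdisj : Pairwise (Function.onFun Disjoint T) := by
    intro i k hik
    refine Set.disjoint_left.2 fun u hi hk => ?_
    have h1 := hsep _ hi ((i : ℝ) * τ - k * τ) (by
      have : u + (-((i : ℝ) * τ)) • e + ((i : ℝ) * τ - k * τ) • e = u + (-((k : ℝ) * τ)) • e := by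
        rw [add_assoc, ← add_smul]; congr 2; ring
      rw [this]; exact hk)
    rw [← sub_mul, abs_mul, abs_of_pos hτ] at h1
    have h2 : |(i : ℝ) - k| < 1 := by
      by_contra! h
      nlinarith
    have h3 : |(i : ℤ) - k| < 1 := by exact_mod_cast h2
    exact hik (by have := Int.abs_lt_one_iff.1 h3; omega)
  have hsub : (⋃ i ∈ Finset.range N, T i) ⊆ Metric.closedBall v (2 * r) := by
    intro u hu
    simp only [Set.mem_iUnion, Finset.mem_range] at hu
    obtain ⟨i, hi, hu⟩ := hu
    have h1 := hAr hu
    rw [Metric.mem_closedBall, dist_eq_norm] at h1 ⊢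
    have h2 : ‖((i : ℝ) * τ) • e‖ ≤ r := by
      rw [norm_smul, Real.norm_eq_abs, abs_of_nonneg (by positivity), mul_assoc]
      refine le_trans ?_ hN
      have : (i : ℝ) ≤ N := by exact_mod_cast hi.le
      gcongr
    calc ‖u - v‖ = ‖(u + (-((i : ℝ) * τ)) • e - v) + ((i : ℝ) * τ) • e‖ := by
          congr 1; rw [neg_smul]; abel
      _ ≤ r + r := (norm_add_le _ _).trans (add_le_add h1 h2)
      _ = 2 * r := by ring
  calc N * μ A = ∑ i ∈ Finset.range N, μ (T i) := by simp [hTμ]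
    _ = μ (⋃ i ∈ Finset.range N, T i) :=
        (measure_biUnion_finset (fun i _ k _ hik => hdisj hik) fun i _ => hTm i).symm
    _ ≤ _ := measure_mono hsub

/-- Double counting of the pairs of close points of two sets. -/
lemma mul_measure_le_of_measure_inter_closedBall_le [SecondCountableTopology E] (μ : Measure E)
    [SFinite μ] {S W : Set E} (hS : MeasurableSet S) (hW : MeasurableSet W) (r : ℝ) {κ c : ℝ≥0∞}
    (h : ∀ v ∈ W, μ (S ∩ Metric.closedBall v r) ≤ κ) :
    c * μ {u ∈ S | c ≤ μ (W ∩ Metric.closedBall u r)} ≤ κ * μ W := by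
  set D : Set (E × E) := {z | dist z.1 z.2 ≤ r} with hD
  have hDm : MeasurableSet D := (isClosed_le continuous_dist continuous_const).measurableSet
  have e1 (u : E) : (μ.restrict W) (Prod.mk u ⁻¹' D) = μ (W ∩ Metric.closedBall u r) := by
    rw [Measure.restrict_apply' hW, Set.inter_comm]
    congr 2
    ext v; simp [hD, dist_comm]
  have e2 (v : E) : (μ.restrict S) ((fun u => (u, v)) ⁻¹' D) = μ (S ∩ Metric.closedBall v r) := by
    rw [Measure.restrict_apply' hS, Set.inter_comm]
    rfl
  -- Markov's inequality bounds the left side by the measure of the pairs at distance at most `r`;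
  -- Tonelli integrates it in the other order.
  calc c * μ {u ∈ S | c ≤ μ (W ∩ Metric.closedBall u r)}
      = c * (μ.restrict S) {u | c ≤ (μ.restrict W) (Prod.mk u ⁻¹' D)} := by
        rw [Measure.restrict_apply' hS]
        simp only [e1]
        rw [Set.inter_comm]; rfl
    _ ≤ ∫⁻ u, (μ.restrict W) (Prod.mk u ⁻¹' D) ∂(μ.restrict S) :=
        mul_meas_ge_le_lintegral (measurable_measure_prodMk_left hDm) _
    _ = ((μ.restrict S).prod (μ.restrict W)) D := (Measure.prod_apply hDm).symm
    _ = ∫⁻ v, (μ.restrict S) ((fun u => (u, v)) ⁻¹' D) ∂(μ.restrict W) :=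
        Measure.prod_apply_symm hDm
    _ ≤ ∫⁻ _v in W, κ ∂μ := by
        refine setLIntegral_mono' hW fun v hv => ?_
        rw [e2]; exact h v hv
    _ = κ * μ W := by simp

end Measure

/-- The hypothesis forces `y` and `z` to have the same nearest integer, so there is no wrapping
around the torus. -/
lemma abs_sub_le_distInt_add {y z : ℝ} (h : |y - z| + distInt y + distInt z < 1) :
    |y - z| ≤ distInt y + distInt z := by
  have h1 : |((round y - round z : ℤ) : ℝ)| < 1 := by
    have e : ((round y - round z : ℤ) : ℝ) = (y - z) - (y - round y) + (z - round z) := by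
      push_cast; ring
    rw [e]
    have h1 := abs_add_le ((y - z) - (y - round y)) (z - round z)
    have h2 := abs_sub (y - z) (y - round y)
    unfold distInt at h
    linarith
  have h2 : round y - round z = 0 := Int.abs_lt_one_iff.1 (by exact_mod_cast h1)
  have e : y - z = (y - round y) - (z - round z) := by
    rw [show round y = round z by omega]; ring
  rw [e]
  exact abs_sub _ _

lemma continuousOn_of_abs_sub_le {E : Type*} [NormedAddCommGroup E] {n : ℕ} {U : Set E}
    {φ : E → Fin n → ℝ} {L : ℝ} (hL : 0 < L)
    (hφ : ∀ u ∈ U, ∀ v ∈ U, ∀ i, |φ u i - φ v i| ≤ L * ‖u - v‖) (i : Fin n) :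
    ContinuousOn (fun u => φ u i) U := by
  refine (LipschitzOnWith.of_dist_le_mul (K := ⟨L, hL.le⟩) fun u hu v hv => ?_).continuousOn
  rw [Real.dist_eq, dist_eq_norm]; exact hφ u hu v hv i

lemma measurableSet_forall_distInt_lt {E : Type*} [TopologicalSpace E] [MeasurableSpace E]
    [BorelSpace E] {n : ℕ} {U : Set E} (hU : IsOpen U) {φ : E → Fin n → ℝ}
    (hφ : ∀ i, ContinuousOn (fun u => φ u i) U) (q : ℤ) (θ b : Fin n → ℝ) :
    MeasurableSet {u ∈ U | ∀ i, distInt (q * φ u i + θ i) < b i} := by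
  have : {u ∈ U | ∀ i, distInt (q * φ u i + θ i) < b i} =
      U ∩ ⋂ i, (U ∩ {u | distInt (q * φ u i + θ i) < b i} ∪ Uᶜ) := by
    ext u
    simp only [Set.mem_ofPred_eq, Set.mem_inter_iff, Set.mem_iInter, Set.mem_union,
      Set.mem_compl_iff]
    constructor
    · rintro ⟨h1, h2⟩; exact ⟨h1, fun i => Or.inl ⟨h1, h2 i⟩⟩
    · rintro ⟨h1, h2⟩; exact ⟨h1, fun i => ((h2 i).resolve_right (not_not.2 h1)).2⟩
  rw [this]
  refine hU.measurableSet.inter (MeasurableSet.iInter fun i => MeasurableSet.union ?_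
    hU.measurableSet.compl)
  refine (ContinuousOn.isOpen_inter_preimage (f := fun u => distInt (q * φ u i + θ i)) ?_ hU
    (isOpen_Iio (a := b i))).measurableSet
  exact continuous_distInt.comp_continuousOn
    ((continuousOn_const.mul (hφ i)).add continuousOn_const)

/-! ### Inhomogeneous transference in a chart -/

section Haar

variable {E : Type*} [NormedAddCommGroup E] [NormedSpace ℝ E] [FiniteDimensional ℝ E]
  [MeasurableSpace E] [BorelSpace E] (μ : Measure E) [μ.IsAddHaarMeasure]

/-- A quantitative form of the transference principle at a fixed height: outside of a small set,
the points of `G` do not have a good inhomogeneous approximation with denominator in `F`, if the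
points of `G` do not have a good homogeneous approximation with denominator in `F - F`. -/
lemma measure_iUnion_inhom_le {n : ℕ} {U : Set E} (hU : IsOpen U) {φ : E → Fin n → ℝ} {L : ℝ}
    (hL : 0 < L) (hφ : ∀ u ∈ U, ∀ v ∈ U, ∀ i, |φ u i - φ v i| ≤ L * ‖u - v‖) {j : Fin n} {e : E}
    (he0 : e ≠ 0) {c : ℝ} (hc : 0 < c)
    (he : ∀ u ∈ U, ∀ s : ℝ, u + s • e ∈ U → c * |s| ≤ |φ (u + s • e) j - φ u j|)
    (θ a A : Fin n → ℝ) (ha : 0 < a j) (haA : ∀ i, a i ≤ A i) (hA : ∀ i, A j ≤ A i)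
    (hA4 : 4 * A j < 1) (hlarge : 4 * L * ‖e‖ * a j ≤ c * A j) (F : Finset ℤ) (hF : 0 ∉ F)
    {G : Set E} (hG : MeasurableSet G) (hGU : G ⊆ U)
    (hGF : ∀ u ∈ G, ∀ q ∈ F, ∀ q' ∈ F, q ≠ q' →
      ∃ i, 4 * A i ≤ distInt (((q - q' : ℤ) : ℝ) * φ u i)) :
    μ (⋃ q ∈ F, {u ∈ U | (∀ i, distInt (q * φ u i + θ i) < a i) ∧
        Metric.closedBall u (A j / (L * |(q : ℝ)|)) ⊆ U ∧
        2⁻¹ * μ (Metric.closedBall 0 (A j / (L * |(q : ℝ)|))) ≤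
          μ (G ∩ Metric.closedBall u (A j / (L * |(q : ℝ)|)))}) ≤
      ENNReal.ofReal (2 ^ (Module.finrank ℝ E + 3) * (L * ‖e‖ / c) * (a j / A j)) * μ U := by
  have hAj : 0 < A j := ha.trans_le (haA j)
  have hepos : 0 < ‖e‖ := norm_pos_iff.2 he0
  have hopen (q : ℤ) (b : Fin n → ℝ) :
      MeasurableSet {u ∈ U | ∀ i, distInt (q * φ u i + θ i) < b i} :=
    measurableSet_forall_distInt_lt hU (continuousOn_of_abs_sub_le hL hφ) q θ b
  set S : ℤ → Set E := fun q => {u ∈ U | ∀ i, distInt (q * φ u i + θ i) < a i} with hS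
  set W : ℤ → Set E := fun q => G ∩ {u ∈ U | ∀ i, distInt (q * φ u i + θ i) < 2 * A i} with hW
  have hWm (q) : MeasurableSet (W q) := hG.inter (hopen q fun i => 2 * A i)
  set r : ℤ → ℝ := fun q => A j / (L * |(q : ℝ)|) with hr
  set C : ℝ := 2 ^ (Module.finrank ℝ E + 3) * (L * ‖e‖ / c) * (a j / A j) with hC
  have hC0 : 0 < C := by positivity
  have hsingle (q : ℤ) (hq : q ∈ F) :
      μ {u ∈ U | (∀ i, distInt (q * φ u i + θ i) < a i) ∧ Metric.closedBall u (r q) ⊆ U ∧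
        2⁻¹ * μ (Metric.closedBall 0 (r q)) ≤ μ (G ∩ Metric.closedBall u (r q))} ≤
      ENNReal.ofReal C * μ (W q) := by
    have hq0 : (0 : ℝ) < |(q : ℝ)| := by
      have : q ≠ 0 := fun h => hF (h ▸ hq)
      positivity
    have hrq : 0 < r q := by positivity
    set m := μ (Metric.closedBall (0 : E) (r q)) with hm
    have hm0 : m ≠ 0 := (Metric.measure_closedBall_pos μ _ hrq).ne'
    have hmtop : m ≠ ⊤ := measure_closedBall_lt_top.ne
    -- In a ball of radius `r q` the value `q * φ j` varies by at most `2 * A j`, so `4 * A j < 1`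
    -- rules out wrapping. Along `e` the set `S q` then has extent below `2 * a j / (c * |q|)`, and
    -- about `ρ` disjoint translates fit into the ball of twice the radius.
    have hslab (v : E) : μ (S q ∩ Metric.closedBall v (r q)) ≤
        ENNReal.ofReal (C / 2) * m := by
      set ρ : ℝ := c * A j / (2 * L * ‖e‖ * a j) with hρ
      have hρ2 : 2 ≤ ρ := by rw [hρ, le_div_iff₀ (by positivity)]; linarith
      have hρ0 : 0 < ρ := by linarith
      set N := ⌊ρ⌋₊ with hN
      have hNρ : (N : ℝ) ≤ ρ := Nat.floor_le hρ0.le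
      have hNρ' : ρ / 2 ≤ N := by
        have := Nat.lt_floor_add_one ρ
        linarith
      have h1 := nsmul_measure_le_of_translates μ (A := S q ∩ Metric.closedBall v (r q))
        ((hopen q a).inter Metric.isClosed_closedBall.measurableSet) (v := v) (e := e) (r := r q)
        (τ := 2 * a j / (c * |(q : ℝ)|)) (N := N) Set.inter_subset_right (by positivity) (by
          rintro u ⟨hu1, hu2⟩ s ⟨hs1, hs2⟩
          have hd : ‖u + s • e - u‖ ≤ 2 * r q := by
            rw [← dist_eq_norm]
            calc dist (u + s • e) u ≤ dist (u + s • e) v + dist u v := dist_triangle_right _ _ _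
              _ ≤ r q + r q := add_le_add hs2 hu2
              _ = _ := by ring
          have hlip := (hφ _ hs1.1 _ hu1.1 j).trans (mul_le_mul_of_nonneg_left hd hL.le)
          have e1 : (q * φ (u + s • e) j + θ j) - (q * φ u j + θ j) =
              q * (φ (u + s • e) j - φ u j) := by ring
          have e2 : |(q * φ (u + s • e) j + θ j) - (q * φ u j + θ j)| ≤ 2 * A j := by
            rw [e1, abs_mul]
            calc |(q : ℝ)| * |φ (u + s • e) j - φ u j| ≤ |(q : ℝ)| * (L * (2 * r q)) := by gcongr
              _ = 2 * A j := by simp only [hr]; field_simp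
          have d1 := hs1.2 j
          have d2 := hu1.2 j
          have d3 := haA j
          have e3 := abs_sub_le_distInt_add (y := q * φ (u + s • e) j + θ j)
            (z := q * φ u j + θ j) (by linarith)
          rw [e1, abs_mul] at e3
          have e4 := mul_le_mul_of_nonneg_left (he u hu1.1 s hs1.1) hq0.le
          rw [lt_div_iff₀ (by positivity)]
          nlinarith) (by
          calc (N : ℝ) * (2 * a j / (c * |(q : ℝ)|) * ‖e‖)
              ≤ ρ * (2 * a j / (c * |(q : ℝ)|) * ‖e‖) := by gcongr
            _ = r q := by simp only [hρ, hr]; field_simp)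
      have h2 : μ (Metric.closedBall v (2 * r q)) =
          ENNReal.ofReal (2 ^ Module.finrank ℝ E) * m := by
        rw [hm, Measure.addHaar_closedBall μ v (by positivity),
          Measure.addHaar_closedBall μ (0 : E) hrq.le, mul_pow, ENNReal.ofReal_mul (by positivity),
          mul_assoc]
      rw [h2] at h1
      have h3 : ENNReal.ofReal (2 / ρ) * N ≥ 1 := by
        rw [← ENNReal.ofReal_natCast, ← ENNReal.ofReal_mul (by positivity), ge_iff_le,
          ENNReal.one_le_ofReal, div_mul_eq_mul_div, le_div_iff₀ hρ0]
        linarith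
      calc μ (S q ∩ Metric.closedBall v (r q))
          ≤ (ENNReal.ofReal (2 / ρ) * N) * μ (S q ∩ Metric.closedBall v (r q)) :=
            le_mul_of_one_le_left' h3
        _ ≤ ENNReal.ofReal (2 / ρ) * (ENNReal.ofReal (2 ^ Module.finrank ℝ E) * m) := by
            rw [mul_assoc]; gcongr
        _ = ENNReal.ofReal (C / 2) * m := by
            rw [← mul_assoc, ← ENNReal.ofReal_mul (by positivity)]
            congr 2
            simp only [hC, hρ, pow_add]; field_simp
    have hdc := mul_measure_le_of_measure_inter_closedBall_le μ (hopen q a) (hWm q) (r q)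
      (c := 2⁻¹ * m) (fun v _ => hslab v)
    -- Moving by at most `r q` changes each `q * φ i` by at most `A j ≤ A i`, so `a i`-closeness at
    -- `u` becomes `2 * A i`-closeness on the whole ball.
    have hsub : {u ∈ U | (∀ i, distInt (q * φ u i + θ i) < a i) ∧ Metric.closedBall u (r q) ⊆ U ∧
        2⁻¹ * m ≤ μ (G ∩ Metric.closedBall u (r q))} ⊆
        {u ∈ S q | 2⁻¹ * m ≤ μ (W q ∩ Metric.closedBall u (r q))} := by
      rintro u ⟨hu, h1, h2, h3⟩
      refine ⟨⟨hu, h1⟩, h3.trans (measure_mono ?_)⟩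
      rintro v ⟨hvG, hvu⟩
      refine ⟨⟨hvG, h2 hvu, fun i => ?_⟩, hvu⟩
      have d1 := distInt_le_add_abs_sub (q * φ v i + θ i) (q * φ u i + θ i)
      have d2 : |(q * φ v i + θ i) - (q * φ u i + θ i)| ≤ A j := by
        have e1 : (q * φ v i + θ i) - (q * φ u i + θ i) = q * (φ v i - φ u i) := by ring
        rw [e1, abs_mul]
        have hd : ‖v - u‖ ≤ r q := by rw [← dist_eq_norm]; exact hvu
        calc |(q : ℝ)| * |φ v i - φ u i| ≤ |(q : ℝ)| * (L * r q) := by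
              gcongr; exact (hφ v (h2 hvu) u hu i).trans (by gcongr)
          _ = A j := by simp only [hr]; field_simp
      have := h1 i
      have := haA i
      have := hA i
      linarith
    have h4 : (2⁻¹ * m) * μ {u ∈ U | (∀ i, distInt (q * φ u i + θ i) < a i) ∧
        Metric.closedBall u (r q) ⊆ U ∧ 2⁻¹ * m ≤ μ (G ∩ Metric.closedBall u (r q))} ≤
        (2⁻¹ * m) * (ENNReal.ofReal C * μ (W q)) := by
      refine (mul_le_mul_right (measure_mono hsub) _).trans (hdc.trans_eq ?_)
      rw [show C / 2 = 2⁻¹ * C by ring, ENNReal.ofReal_mul (by norm_num),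
        ENNReal.ofReal_inv_of_pos (by norm_num), ENNReal.ofReal_ofNat]
      ring
    refine (ENNReal.mul_le_mul_iff_right ?_ ?_).1 h4
    · simp [hm0]
    · exact ENNReal.mul_ne_top (by simp) hmtop
  -- A common point would make `(q - q') * φ i` closer than `4 * A i` to an integer for all `i`;
  -- subtraction eliminates `θ`.
  have hdisj : (F : Set ℤ).PairwiseDisjoint W := by
    intro q hq q' hq' hqq'
    refine Set.disjoint_left.2 ?_
    rintro u ⟨huG, -, h1⟩ ⟨-, -, h2⟩
    obtain ⟨i, hi⟩ := hGF u huG q hq q' hq' hqq'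
    have h3 := distInt_sub_le (q * φ u i + θ i) (q' * φ u i + θ i)
    have e1 : (q * φ u i + θ i) - (q' * φ u i + θ i) = ((q - q' : ℤ) : ℝ) * φ u i := by
      push_cast; ring
    rw [e1] at h3
    have := h1 i
    have := h2 i
    linarith
  calc _ ≤ ∑ q ∈ F, μ {u ∈ U | (∀ i, distInt (q * φ u i + θ i) < a i) ∧
        Metric.closedBall u (r q) ⊆ U ∧
        2⁻¹ * μ (Metric.closedBall 0 (r q)) ≤ μ (G ∩ Metric.closedBall u (r q))} :=
        measure_biUnion_finset_le _ _
    _ ≤ ∑ q ∈ F, ENNReal.ofReal C * μ (W q) := Finset.sum_le_sum hsingle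
    _ = ENNReal.ofReal C * μ (⋃ q ∈ F, W q) := by
        rw [← Finset.mul_sum, measure_biUnion_finset hdisj fun q _ => hWm q]
    _ ≤ _ := by
        gcongr
        exact Set.iUnion₂_subset fun q _ => Set.inter_subset_left.trans hGU

end Haar

/-- The inhomogeneous transference principle in a chart: if almost no point has infinitely many
good homogeneous approximations, then almost no point has infinitely many good inhomogeneous
approximations of a slightly better quality. -/
lemma ae_eventually_exists_le_distInt {E : Type*} [NormedAddCommGroup E] [NormedSpace ℝ E]
    [FiniteDimensional ℝ E] [MeasurableSpace E] [BorelSpace E] (μ : Measure E)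
    [μ.IsAddHaarMeasure] {n : ℕ} {U : Set E} (hU : IsOpen U) (hμU : μ U ≠ ⊤)
    {φ : E → Fin n → ℝ} {L : ℝ} (hL : 0 < L)
    (hφ : ∀ u ∈ U, ∀ v ∈ U, ∀ i, |φ u i - φ v i| ≤ L * ‖u - v‖) {j : Fin n} {e : E}
    (he0 : e ≠ 0) {c : ℝ} (hc : 0 < c)
    (he : ∀ u ∈ U, ∀ s : ℝ, u + s • e ∈ U → c * |s| ≤ |φ (u + s • e) j - φ u j|)
    (θ : Fin n → ℝ) (a A : ℕ → Fin n → ℝ) (ha : ∀ t, 0 < a t j) (haA : ∀ t i, a t i ≤ A t i)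
    (hA : ∀ t i, A t j ≤ A t i) (hA0 : Tendsto (fun t => A t j) atTop (𝓝 0))
    (hsum : Summable fun t => a t j / A t j)
    (hyp : ∀ᵐ u ∂μ.restrict U, ∀ᶠ t : ℕ in atTop, ∀ q : ℤ, q ≠ 0 → |(q : ℝ)| ≤ 2 ^ (t + 1) →
      ∃ i, 4 * A t i ≤ distInt (q * φ u i)) :
    ∀ᵐ u ∂μ.restrict U, ∀ᶠ t : ℕ in atTop, ∀ q : ℤ, q ≠ 0 → |(q : ℝ)| ≤ 2 ^ t →
      ∃ i, a t i ≤ distInt (q * φ u i + θ i) := by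
  have hcont := continuousOn_of_abs_sub_le hL hφ
  have hApos (t) : 0 < A t j := (ha t).trans_le (haA t j)
  set G : ℕ → Set E := fun T => {u ∈ U | ∀ t ≥ T, ∀ q : ℤ, q ≠ 0 → |(q : ℝ)| ≤ 2 ^ (t + 1) →
      ∃ i, 4 * A t i ≤ distInt (q * φ u i)} with hG
  have hGU (T) : G T ⊆ U := fun u hu => hu.1
  have hGm (T) : MeasurableSet (G T) := by
    have : G T = U \ ⋃ (t : ℕ) (_ : T ≤ t) (q : ℤ) (_ : q ≠ 0) (_ : |(q : ℝ)| ≤ 2 ^ (t + 1)),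
        {u ∈ U | ∀ i, distInt (q * φ u i + (0 : Fin n → ℝ) i) < 4 * A t i} := by
      ext u
      simp only [hG, Set.mem_ofPred_eq, Set.mem_sdiff, Set.mem_iUnion, not_exists, not_and,
        not_forall, not_lt, Pi.zero_apply, add_zero, exists_prop]
      exact ⟨fun h => ⟨h.1, fun t ht q hq hqt _ => h.2 t ht q hq hqt⟩,
        fun h => ⟨h.1, fun t ht q hq hqt => h.2 t ht q hq hqt h.1⟩⟩
    rw [this]
    refine hU.measurableSet.diff (MeasurableSet.iUnion fun t => MeasurableSet.iUnion fun _ =>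
      MeasurableSet.iUnion fun q => MeasurableSet.iUnion fun _ => MeasurableSet.iUnion fun _ => ?_)
    exact measurableSet_forall_distInt_lt hU hcont q 0 fun i => 4 * A t i
  -- Differences of elements of `F t` are at most `2 ^ (t + 1)`, the height at which `G` controls
  -- the homogeneous problem.
  set F : ℕ → Finset ℤ := fun t => (Finset.Icc (-2 ^ t) (2 ^ t)).erase 0 with hF
  set r : ℕ → ℤ → ℝ := fun t q => A t j / (L * |(q : ℝ)|) with hr
  set B : ℕ → ℕ → Set E := fun T t => ⋃ q ∈ F t, {u ∈ U |
      (∀ i, distInt (q * φ u i + θ i) < a t i) ∧ Metric.closedBall u (r t q) ⊆ U ∧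
        2⁻¹ * μ (Metric.closedBall 0 (r t q)) ≤ μ (G T ∩ Metric.closedBall u (r t q))} with hB
  set C : ℝ := 2 ^ (Module.finrank ℝ E + 3) * (L * ‖e‖ / c) with hC
  have hC0 : 0 ≤ C := by positivity
  have hlarge : ∀ᶠ t in atTop, 4 * A t j < 1 ∧ 4 * L * ‖e‖ * a t j ≤ c * A t j := by
    have hepos : 0 < ‖e‖ := norm_pos_iff.2 he0
    filter_upwards [hA0.eventually_lt_const (show (0 : ℝ) < 1 / 4 by norm_num),
      hsum.tendsto_atTop_zero.eventually_lt_const (show 0 < c / (4 * L * ‖e‖) by positivity)]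
      with t h1 h2
    refine ⟨by linarith, ?_⟩
    rw [div_lt_div_iff₀ (hApos t) (by positivity)] at h2
    linarith
  have hlevel (T : ℕ) : ∀ᶠ t in atTop, μ (B T t) ≤ ENNReal.ofReal (C * (a t j / A t j)) * μ U := by
    filter_upwards [hlarge, eventually_ge_atTop T] with t ht htT
    refine measure_iUnion_inhom_le μ hU hL hφ he0 hc he θ (a t) (A t) (ha t) (haA t) (hA t) ht.1
      ht.2 (F t) (by simp [hF]) (hGm T) (hGU T) fun u hu q hq q' hq' hqq' => ?_
    refine hu.2 t htT (q - q') (sub_ne_zero.2 hqq') ?_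
    simp only [hF, Finset.mem_erase, Finset.mem_Icc] at hq hq'
    have : |q - q'| ≤ 2 ^ (t + 1) := by
      rw [pow_succ, abs_le]; constructor <;> linarith
    exact_mod_cast this
  -- Borel-Cantelli, with the summability of `a t j / A t j`.
  have hBC (T : ℕ) : ∀ᵐ u ∂μ, ∀ᶠ t in atTop, u ∉ B T t := by
    obtain ⟨T₀, hT₀⟩ := eventually_atTop.1 (hlevel T)
    have hs : ∑' k, μ (B T (k + T₀)) ≠ ⊤ := by
      have h1 : ∑' k, μ (B T (k + T₀)) ≤
          ∑' k, ENNReal.ofReal (C * (a (k + T₀) j / A (k + T₀) j)) * μ U :=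
        ENNReal.tsum_le_tsum fun k => hT₀ _ (by omega)
      refine ne_top_of_le_ne_top ?_ h1
      rw [ENNReal.tsum_mul_right]
      refine ENNReal.mul_ne_top ?_ hμU
      exact ((hsum.mul_left C).comp_injective (add_left_injective T₀)).tsum_ofReal_ne_top
    filter_upwards [ae_eventually_notMem hs] with u hu
    obtain ⟨K, hK⟩ := eventually_atTop.1 hu
    refine eventually_atTop.2 ⟨K + T₀, fun t ht => ?_⟩
    have := hK (t - T₀) (by omega)
    rwa [Nat.sub_add_cancel (by omega)] at this
  -- Almost every point of `G T` is a density point, so small balls are at least half filled.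
  have hdens (T : ℕ) : ∀ᵐ u ∂μ, u ∈ G T → ∀ᶠ ρ in 𝓝[>] (0 : ℝ),
      2⁻¹ * μ (Metric.closedBall 0 ρ) ≤ μ (G T ∩ Metric.closedBall u ρ) := by
    rw [← ae_restrict_iff' (hGm T)]
    filter_upwards [Besicovitch.ae_tendsto_measure_inter_div μ (G T)] with u hu
    filter_upwards [hu.eventually_const_le (show (2⁻¹ : ℝ≥0∞) < 1 by simp),
      self_mem_nhdsWithin] with ρ h1 h2
    rw [← Measure.addHaar_closedBall_center μ u]
    have h3 : μ (Metric.closedBall u ρ) ≠ 0 := (Metric.measure_closedBall_pos μ u h2).ne'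
    rwa [ENNReal.le_div_iff_mul_le (Or.inl h3) (Or.inl measure_closedBall_lt_top.ne)] at h1
  filter_upwards [hyp, ae_restrict_of_ae (ae_all_iff.2 hBC), ae_restrict_of_ae (ae_all_iff.2 hdens),
    ae_restrict_mem hU.measurableSet] with u h1 h2 h3 huU
  obtain ⟨T, hT⟩ := eventually_atTop.1 h1
  have huG : u ∈ G T := ⟨huU, hT⟩
  have hball : ∀ᶠ ρ in 𝓝[>] (0 : ℝ), Metric.closedBall u ρ ⊆ U := by
    obtain ⟨δ, hδ, hδU⟩ := Metric.isOpen_iff.1 hU u huU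
    filter_upwards [Ioo_mem_nhdsGT hδ] with ρ hρ
    exact (Metric.closedBall_subset_ball hρ.2).trans hδU
  obtain ⟨δ, hδ, hδ2⟩ := mem_nhdsGT_iff_exists_Ioo_subset.1 ((h3 T huG).and hball)
  have hsmall : ∀ᶠ t in atTop, A t j < δ * L :=
    hA0.eventually_lt_const (mul_pos hδ hL)
  filter_upwards [h2 T, hsmall] with t ht1 ht2 q hq hqt
  by_contra! hcon
  refine ht1 (Set.mem_iUnion₂.2 ⟨q, ?_, huU, hcon, ?_⟩)
  · simp only [hF, Finset.mem_erase, Finset.mem_Icc]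
    refine ⟨hq, abs_le.1 ?_⟩
    exact_mod_cast hqt
  · have hq1 : (1 : ℝ) ≤ |(q : ℝ)| := by exact_mod_cast Int.one_le_abs hq
    -- Since `|q| ≥ 1`, the radius is at most `A t j / L`, hence small uniformly in `q`.
    have hmem : r t q ∈ Set.Ioo 0 δ := by
      have := hApos t
      refine ⟨by simp only [hr]; positivity, ?_⟩
      simp only [hr]
      rw [div_lt_iff₀ (by positivity)]
      refine ht2.trans_le ?_
      have h0 : 0 < δ := hδ
      have : 0 < δ * L := by positivity
      nlinarith
    exact ⟨(hδ2 hmem).2, (hδ2 hmem).1⟩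

/-! ### Null sets of submanifolds -/

/-- The two measures differ by a nonzero constant factor, so Lipschitz bounds for `μH[d]` apply to
null sets of `μHE[d]`. -/
lemma euclideanHausdorffMeasure_eq_zero_iff {X : Type*} [EMetricSpace X] [MeasurableSpace X]
    [BorelSpace X] (d : ℕ) (s : Set X) :
    (μHE[d] : Measure X) s = 0 ↔ (μH[d] : Measure X) s = 0 := by
  have h : (μHE[d] : Measure X) s = ((volume : Measure (EuclideanSpace ℝ (Fin d))
      ).addHaarScalarFactor μH[d] : ℝ≥0∞) * (μH[d] : Measure X) s := rfl
  rw [h, mul_eq_zero, ENNReal.coe_eq_zero, or_iff_right (Measure.addHaarScalarFactor_volume_hausdorffMeasure_ne_zero d)]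

lemma euclideanHausdorffMeasure_image_eq_zero {X Y : Type*} [EMetricSpace X] [MeasurableSpace X]
    [BorelSpace X] [EMetricSpace Y] [MeasurableSpace Y] [BorelSpace Y] {d : ℕ} {f : X → Y}
    {K : ℝ≥0} {s t : Set X} (hf : LipschitzOnWith K f s) (hts : t ⊆ s)
    (ht : (μHE[d] : Measure X) t = 0) : (μHE[d] : Measure Y) (f '' t) = 0 := by
  rw [euclideanHausdorffMeasure_eq_zero_iff] at *
  have := (hf.mono hts).hausdorffMeasure_image_le (d := d) (Nat.cast_nonneg d)
  rwa [ht, mul_zero, nonpos_iff_eq_zero] at this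

lemma IsLocalParam.injOn {n d : ℕ} {M : Set (EuclideanSpace ℝ (Fin n))}
    {U : Set (EuclideanSpace ℝ (Fin d))} {f : EuclideanSpace ℝ (Fin d) → EuclideanSpace ℝ (Fin n)}
    (h : IsLocalParam d M U f) : Set.InjOn f U :=
  Set.injOn_iff_injective.2 h.isEmbedding.injective

lemma IsLocalParam.image_subset {n d : ℕ} {M : Set (EuclideanSpace ℝ (Fin n))}
    {U : Set (EuclideanSpace ℝ (Fin d))} {f : EuclideanSpace ℝ (Fin d) → EuclideanSpace ℝ (Fin n)}
    (h : IsLocalParam d M U f) : f '' U ⊆ M := by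
  obtain ⟨V, -, hV⟩ := h.image_eq
  exact hV ▸ Set.inter_subset_left

/-- A local parametrization maps neighbourhoods to relative neighbourhoods. -/
lemma IsLocalParam.image_mem_nhdsWithin {n d : ℕ} {M : Set (EuclideanSpace ℝ (Fin n))}
    {U : Set (EuclideanSpace ℝ (Fin d))} {f : EuclideanSpace ℝ (Fin d) → EuclideanSpace ℝ (Fin n)}
    (h : IsLocalParam d M U f) {B : Set (EuclideanSpace ℝ (Fin d))} (hB : IsOpen B) (hBU : B ⊆ U)
    {u : EuclideanSpace ℝ (Fin d)} (hu : u ∈ B) : f '' B ∈ 𝓝[M] (f u) := by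
  obtain ⟨V, hVo, hV⟩ := h.image_eq
  obtain ⟨O, hO, hOB⟩ := h.isEmbedding.isInducing.isOpen_iff.1
    (hB.preimage (continuous_subtype_val (p := fun x => x ∈ U)))
  have hmem {w} (hw : w ∈ U) : f w ∈ O ↔ w ∈ B :=
    Set.ext_iff.1 hOB ⟨w, hw⟩
  have hsub : M ∩ (V ∩ O) ⊆ f '' B := by
    rintro y ⟨hyM, hyV, hyO⟩
    obtain ⟨w, hw, rfl⟩ : y ∈ f '' U := hV ▸ ⟨hyM, hyV⟩
    exact ⟨w, (hmem hw).1 hyO, rfl⟩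
  refine mem_of_superset ?_ hsub
  have hfu : f u ∈ M ∩ V := hV ▸ ⟨u, hBU hu, rfl⟩
  exact inter_mem_nhdsWithin M ((hVo.inter hO).mem_nhds ⟨hfu.2, (hmem (hBU hu)).2 hu⟩)

/-- By the Lindelöf property countably many chart images cover `M`, and each is a Borel set as an
injective continuous image of an open set. -/
lemma IsSubmanifold.measurableSet {n d : ℕ} {M : Set (EuclideanSpace ℝ (Fin n))}
    (hM : IsSubmanifold d M) : MeasurableSet M := by
  choose! U f hf hy using hM
  obtain ⟨t, htM, htc, htU⟩ := TopologicalSpace.countable_cover_nhdsWithin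
    (f := fun y => f y '' U y) (s := M) fun y hyM => by
      obtain ⟨u, hu, hfu⟩ := hy y hyM
      have := (hf y hyM).image_mem_nhdsWithin (hf y hyM).isOpen subset_rfl hu
      rwa [hfu] at this
  have : M = ⋃ y ∈ t, f y '' U y :=
    htU.antisymm (Set.iUnion₂_subset fun y hyt => (hf y (htM hyt)).image_subset)
  rw [this]
  exact MeasurableSet.biUnion htc fun y hyt => (hf y (htM hyt)).isOpen.measurableSet
    |>.image_of_continuousOn_injOn (hf y (htM hyt)).contDiffOn.continuousOn (hf y (htM hyt)).injOn

/-- An immersion is, locally, bi-Lipschitz, and each coordinate with a nonzero derivative in some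
direction is strictly monotone in this direction. -/
lemma exists_mem_nhds_biLipschitz {n d : ℕ}
    {f : EuclideanSpace ℝ (Fin d) → EuclideanSpace ℝ (Fin n)} {u₀ v : EuclideanSpace ℝ (Fin d)}
    {f' : EuclideanSpace ℝ (Fin d) →L[ℝ] EuclideanSpace ℝ (Fin n)} (hf : HasStrictFDerivAt f f' u₀)
    (hinj : Function.Injective f') {j : Fin n} (hv : f' v j ≠ 0) :
    ∃ V ∈ 𝓝 u₀, ∃ L K : ℝ≥0, ∃ c : ℝ, 0 < c ∧ 0 < L ∧ LipschitzOnWith L f V ∧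
      (∀ x ∈ V, ∀ y ∈ V, dist x y ≤ K * dist (f x) (f y)) ∧
      ∀ x ∈ V, ∀ s : ℝ, x + s • v ∈ V → c * |s| ≤ |f (x + s • v) j - f x j| := by
  obtain ⟨K₀, hK₀, hanti⟩ :=
    (f' : EuclideanSpace ℝ (Fin d) →ₗ[ℝ] EuclideanSpace ℝ (Fin n)).exists_antilipschitzWith
      (LinearMap.ker_eq_bot.2 hinj)
  have hK₀r : (0 : ℝ) < K₀ := hK₀
  have hv0 : v ≠ 0 := by rintro rfl; simp at hv
  have hvpos : 0 < ‖v‖ := norm_pos_iff.2 hv0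
  have hjpos : 0 < |f' v j| := abs_pos.2 hv
  -- The first term leaves half of the expansion of `f'`, the second half of the derivative of
  -- coordinate `j` along `v`.
  set ε : ℝ := min (1 / (2 * K₀)) (|f' v j| / (2 * ‖v‖)) with hε
  have hε0 : 0 < ε := by positivity
  obtain ⟨V, hV, happ⟩ := hf.approximates_deriv_on_nhds (c := ⟨ε, hε0.le⟩) (Or.inr hε0)
  have happ' : ∀ x ∈ V, ∀ y ∈ V, ‖f x - f y - f' (x - y)‖ ≤ ε * ‖x - y‖ :=
    fun x hx y hy => happ x hx y hy
  have hanti' (x) : ‖x‖ ≤ K₀ * ‖f' x‖ := by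
    have := hanti.le_mul_dist x 0
    simpa using this
  refine ⟨V, hV, ‖f'‖₊ + ⟨ε, hε0.le⟩, 2 * K₀, |f' v j| / 2, by positivity, ?_, ?_,
    fun x hx y hy => ?_, fun x hx s hxs => ?_⟩
  · exact add_pos_of_nonneg_of_pos zero_le hε0
  · refine LipschitzOnWith.of_dist_le_mul fun x hx y hy => ?_
    rw [dist_eq_norm, dist_eq_norm]
    have h1 := happ' x hx y hy
    have h2 := f'.le_opNorm (x - y)
    have h3 : ‖f x - f y‖ ≤ ‖f x - f y - f' (x - y)‖ + ‖f' (x - y)‖ := by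
      simpa using norm_add_le (f x - f y - f' (x - y)) (f' (x - y))
    calc ‖f x - f y‖ ≤ ε * ‖x - y‖ + ‖f'‖ * ‖x - y‖ := by linarith
      _ = _ := by rw [add_comm, ← add_mul]; rfl
  · rw [dist_eq_norm, dist_eq_norm]
    have h1 := happ' x hx y hy
    have h2 := hanti' (x - y)
    have h3 : ‖f' (x - y)‖ ≤ ‖f x - f y‖ + ‖f x - f y - f' (x - y)‖ := by
      have := norm_sub_le (f x - f y) (f x - f y - f' (x - y))
      simpa using this
    have h4 : ε * ‖x - y‖ ≤ 1 / (2 * K₀) * ‖x - y‖ := by gcongr; exact min_le_left _ _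
    have h5 : K₀ * (1 / (2 * K₀) * ‖x - y‖) = ‖x - y‖ / 2 := by field_simp
    have h6 := mul_le_mul_of_nonneg_left (h3.trans (add_le_add_right (h1.trans h4) _)) hK₀r.le
    rw [mul_add, h5] at h6
    push_cast
    linarith
  · have h1 := happ' _ hxs x hx
    rw [add_sub_cancel_left, norm_smul, Real.norm_eq_abs, map_smul] at h1
    have h2 := (PiLp.norm_apply_le (f (x + s • v) - f x - s • f' v) j).trans h1
    simp only [PiLp.sub_apply, PiLp.smul_apply, smul_eq_mul, Real.norm_eq_abs] at h2
    have h3 : ε * (|s| * ‖v‖) ≤ |f' v j| / (2 * ‖v‖) * (|s| * ‖v‖) := by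
      gcongr; exact min_le_right _ _
    have h4 : |f' v j| / (2 * ‖v‖) * (|s| * ‖v‖) = |f' v j| / 2 * |s| := by field_simp
    have h5 : |s * f' v j| ≤ |f (x + s • v) j - f x j| +
        |f (x + s • v) j - f x j - s * f' v j| := by
      have := abs_sub (f (x + s • v) j - f x j) (f (x + s • v) j - f x j - s * f' v j)
      simpa using this
    rw [abs_mul] at h5
    linarith

/-- The inhomogeneous transference principle on a submanifold, for boxes with sides
`2 ^ (-(t * σ i))`. -/
lemma IsSubmanifold.ae_eventually_exists_le_distInt {n d : ℕ}
    {M : Set (EuclideanSpace ℝ (Fin n))} (hM : IsSubmanifold d M) (σ : Fin n → ℝ) {η : ℝ}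
    (hη : 0 < η) (θ : Fin n → ℝ)
    (hdir : ∀ᵐ y ∂(riemannianMeasure d M), ∃ j, (∀ i, σ i ≤ σ j) ∧ η < σ j ∧
      ∃ U f, IsLocalParam d M U f ∧ ∃ u ∈ U, f u = y ∧ ∃ v, fderiv ℝ f u v j ≠ 0)
    (hyp : ∀ᵐ x ∂(riemannianMeasure d M), ∀ᶠ t : ℕ in atTop, ∀ q : ℤ, q ≠ 0 →
      |(q : ℝ)| ≤ 2 ^ (t + 1) → ∃ i, 4 * (2 : ℝ) ^ (-(t * (σ i - η))) ≤ distInt (q * x i)) :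
    ∀ᵐ x ∂(riemannianMeasure d M), ∀ᶠ t : ℕ in atTop, ∀ q : ℤ, q ≠ 0 →
      |(q : ℝ)| ≤ 2 ^ t → ∃ i, (2 : ℝ) ^ (-(t * σ i)) ≤ distInt (q * x i + θ i) := by
  have hMm := hM.measurableSet
  unfold riemannianMeasure at *
  rw [ae_restrict_iff' hMm] at hdir hyp ⊢
  set H : EuclideanSpace ℝ (Fin n) → Prop := fun x => ∀ᶠ t : ℕ in atTop, ∀ q : ℤ, q ≠ 0 →
      |(q : ℝ)| ≤ 2 ^ (t + 1) → ∃ i, 4 * (2 : ℝ) ^ (-(t * (σ i - η))) ≤ distInt (q * x i) with hH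
  set P : EuclideanSpace ℝ (Fin n) → Prop := fun x => ∀ᶠ t : ℕ in atTop, ∀ q : ℤ, q ≠ 0 →
      |(q : ℝ)| ≤ 2 ^ t → ∃ i, (2 : ℝ) ^ (-(t * σ i)) ≤ distInt (q * x i + θ i) with hP
  have hlocal : ∀ y ∈ M, (∃ j, (∀ i, σ i ≤ σ j) ∧ η < σ j ∧
      ∃ U f, IsLocalParam d M U f ∧ ∃ u ∈ U, f u = y ∧ ∃ v, fderiv ℝ f u v j ≠ 0) →
      ∃ W ∈ 𝓝[M] y, (μHE[d] : Measure (EuclideanSpace ℝ (Fin n))) {x ∈ W | ¬ P x} = 0 := by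
    rintro y hyM ⟨j, hj, hηj, U, f, hf, u₀, hu₀, rfl, v, hv⟩
    have hcd : ContDiffAt ℝ 1 f u₀ := hf.contDiffOn.contDiffAt (hf.isOpen.mem_nhds hu₀)
    obtain ⟨V, hV, L, K, c, hc, hL, hLip, hanti, hmono⟩ := exists_mem_nhds_biLipschitz
      (hcd.hasStrictFDerivAt one_ne_zero) (hf.injective_fderiv u₀ hu₀) hv
    obtain ⟨δ, hδ, hball⟩ := Metric.mem_nhds_iff.1 (inter_mem hV (hf.isOpen.mem_nhds hu₀))
    set B := Metric.ball u₀ δ with hB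
    have hBV : B ⊆ V := hball.trans Set.inter_subset_left
    have hBU : B ⊆ U := hball.trans Set.inter_subset_right
    refine ⟨f '' B, hf.image_mem_nhdsWithin Metric.isOpen_ball hBU (Metric.mem_ball_self hδ), ?_⟩
    -- The inverse of the chart is Lipschitz, so the exceptional null set pulls back to a null set.
    have hHB : ∀ᵐ u ∂(volume.restrict B), H (f u) := by
      rw [ae_restrict_iff' Metric.isOpen_ball.measurableSet, ae_iff,
        ← EuclideanSpace.euclideanHausdorffMeasure_eq_volume]
      have hinjB : Set.InjOn f B := hf.injOn.mono hBU
      have hginv : ∀ u ∈ B, Function.invFunOn f B (f u) = u := fun u hu =>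
        hinjB.leftInvOn_invFunOn hu
      have hgLip : LipschitzOnWith K (Function.invFunOn f B) (f '' B) := by
        refine LipschitzOnWith.of_dist_le_mul ?_
        rintro _ ⟨x, hx, rfl⟩ _ ⟨y, hy, rfl⟩
        rw [hginv x hx, hginv y hy]
        exact hanti x (hBV hx) y (hBV hy)
      have hZ : (μHE[d] : Measure (EuclideanSpace ℝ (Fin n))) {x ∈ f '' B | ¬ H x} = 0 := by
        refine measure_mono_null ?_ (ae_iff.1 hyp)
        rintro _ ⟨⟨u, hu, rfl⟩, hx⟩ h
        exact hx (h (hf.image_subset ⟨u, hBU hu, rfl⟩))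
      refine measure_mono_null ?_
        (euclideanHausdorffMeasure_image_eq_zero hgLip (fun x hx => hx.1) hZ)
      intro u hu
      simp only [Set.mem_ofPred_eq, Classical.not_imp] at hu
      exact ⟨f u, ⟨⟨u, hu.1, rfl⟩, hu.2⟩, hginv u hu.1⟩
    have hv0 : v ≠ 0 := by rintro rfl; simp at hv
    have hlt : (2 : ℝ) ^ (-η) < 1 := Real.rpow_lt_one_of_one_lt_of_neg (by norm_num) (by linarith)
    have hPB := DiophantineSubmanifold.ae_eventually_exists_le_distInt volume
      (Metric.isOpen_ball (x := u₀) (ε := δ)) measure_ball_lt_top.ne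
      (φ := fun u => (f u).ofLp) (L := L) (by exact_mod_cast hL)
      (fun u hu w hw i => by
        have h1 := hLip.dist_le_mul u (hBV hu) w (hBV hw)
        rw [dist_eq_norm, dist_eq_norm] at h1
        exact (PiLp.norm_apply_le (f u - f w) i).trans h1)
      (j := j) hv0 hc (fun u hu s hs => hmono u (hBV hu) s (hBV hs)) θ
      -- The ratio `a / A` is `2 ^ (-t * η)`, hence summable; maximality of `σ j` makes `A j` the
      -- shortest side, and `η < σ j` makes it tend to `0`.
      (fun t i => (2 : ℝ) ^ (-(t * σ i))) (fun t i => (2 : ℝ) ^ (-(t * (σ i - η))))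
      (fun t => by positivity)
      (fun t i => Real.rpow_le_rpow_of_exponent_le (by norm_num) (by
        have : (0 : ℝ) ≤ t * η := by positivity
        linarith))
      (fun t i => Real.rpow_le_rpow_of_exponent_le (by norm_num) (by
        have := mul_le_mul_of_nonneg_left (hj i) (Nat.cast_nonneg (α := ℝ) t)
        linarith))
      (by
        have h1 : (2 : ℝ) ^ (-(σ j - η)) < 1 :=
          Real.rpow_lt_one_of_one_lt_of_neg (by norm_num) (by linarith)
        refine (tendsto_pow_atTop_nhds_zero_of_lt_one (by positivity) h1).congr fun t => ?_
        rw [← Real.rpow_natCast, ← Real.rpow_mul (by norm_num)]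
        congr 1; ring)
      (by
        refine (summable_geometric_of_lt_one (by positivity) hlt).congr fun t => ?_
        rw [← Real.rpow_sub (by norm_num), ← Real.rpow_natCast, ← Real.rpow_mul (by norm_num)]
        congr 1; ring)
      hHB
    rw [ae_restrict_iff' Metric.isOpen_ball.measurableSet, ae_iff,
      ← EuclideanSpace.euclideanHausdorffMeasure_eq_volume] at hPB
    refine measure_mono_null ?_
      (euclideanHausdorffMeasure_image_eq_zero (hLip.mono hBV) (fun u hu => ?_) hPB)
    · rintro _ ⟨⟨u, hu, rfl⟩, hx⟩
      exact ⟨u, fun h => hx (h hu), rfl⟩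
    · by_contra h
      exact hu fun h' => absurd h' h
  set D : Set (EuclideanSpace ℝ (Fin n)) := {y ∈ M | ∃ j, (∀ i, σ i ≤ σ j) ∧ η < σ j ∧
      ∃ U f, IsLocalParam d M U f ∧ ∃ u ∈ U, f u = y ∧ ∃ v, fderiv ℝ f u v j ≠ 0} with hD
  have hnull : (μHE[d] : Measure (EuclideanSpace ℝ (Fin n))) {x ∈ D | ¬ P x} = 0 := by
    refine measure_null_of_locally_null _ fun x hx => ?_
    obtain ⟨W, hW, hW0⟩ := hlocal x hx.1.1 hx.1.2
    refine ⟨_, inter_mem (nhdsWithin_mono x (fun z hz => hz.1.1) hW) self_mem_nhdsWithin,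
      measure_mono_null ?_ hW0⟩
    rintro z ⟨hz1, -, hz2⟩
    exact ⟨hz1, hz2⟩
  have hnull' : ∀ᵐ x ∂(μHE[d] : Measure (EuclideanSpace ℝ (Fin n))), ¬ (x ∈ D ∧ ¬ P x) := by
    rw [ae_iff]; simpa using hnull
  filter_upwards [hnull', hdir] with x hx1 hx2 hxM
  by_contra hPx
  exact hx1 ⟨⟨hxM, hx2 hxM⟩, hPx⟩

/-! ### From powers of two to all heights -/

lemma tendsto_two_pow_atTop : Tendsto (fun t : ℕ => (2 : ℝ) ^ t) atTop atTop :=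
  tendsto_pow_atTop_atTop_of_one_lt (by norm_num)

lemma eventually_exists_two_pow {p : ℕ → Prop} (hp : ∀ᶠ t in atTop, p t) :
    ∀ᶠ Q : ℝ in atTop, ∃ t, p t ∧ Q ≤ 2 ^ t ∧ (2 : ℝ) ^ t ≤ 2 * Q := by
  obtain ⟨T, hT⟩ := eventually_atTop.1 hp
  filter_upwards [eventually_ge_atTop ((2 : ℝ) ^ T), eventually_ge_atTop 1] with Q hQ hQ1
  obtain ⟨t, ht1, ht2⟩ := exists_nat_pow_near hQ1 (show (1 : ℝ) < 2 by norm_num)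
  refine ⟨t + 1, hT _ ?_, ht2.le, by rw [pow_succ]; linarith⟩
  have h := hQ.trans_lt ht2
  exact ((pow_lt_pow_iff_right₀ (show (1 : ℝ) < 2 by norm_num)).1 h).le

lemma two_rpow_neg_natCast_mul (t : ℕ) (s : ℝ) :
    (2 : ℝ) ^ (-(t * s)) = ((2 : ℝ) ^ t) ^ (-s) := by
  rw [← Real.rpow_natCast, ← Real.rpow_mul (by norm_num)]
  congr 1; ring

/-! ### Extremality and inhomogeneous extremality -/

/-- A family of bounds that get stronger as `ε` gets smaller holds for all `ε > 0` if it holds for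
`ε = 1 / (k + 1)`. -/
lemma forall_pos_of_forall_nat {R : ℝ → Prop} (hmono : ∀ ε ε', ε ≤ ε' → R ε → R ε')
    (h : ∀ k : ℕ, R (1 / (k + 1))) (ε : ℝ) (hε : 0 < ε) : R ε := by
  obtain ⟨k, hk⟩ := exists_nat_one_div_lt hε
  exact hmono _ _ hk.le (h k)

lemma ae_simUpper {n d : ℕ} (hd : 1 ≤ d) (hn : 0 < n) {M : Set (EuclideanSpace ℝ (Fin n))}
    (hM : IsSubmanifold d M) (h : ∀ᵐ x ∂(riemannianMeasure d M), SimUpper x.ofLp 0)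
    (θ : Fin n → ℝ) : ∀ᵐ x ∂(riemannianMeasure d M), SimUpper x.ofLp θ := by
  have hn' : (0 : ℝ) < n := by exact_mod_cast hn
  have key (ε : ℝ) (hε : 0 < ε) : ∀ᵐ x ∂(riemannianMeasure d M), ∀ᶠ Q : ℝ in atTop, ∀ q : ℤ,
      q ≠ 0 → |(q : ℝ)| ≤ Q → ∃ j, Q ^ (-((1 + ε) / n)) ≤ distInt (q * x j + θ j) := by
    -- The exponents `ε / 8 < ε / 4` leave room for the homogeneous constants, and `ε / 2 < ε` for
    -- passing from powers of two to all `Q`.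
    set σ : ℝ := (1 + ε / 2) / n with hσ
    set η : ℝ := ε / 4 / n with hη
    have hη0 : 0 < η := by positivity
    have hση : σ - η = (1 + ε / 4) / n := by rw [hσ, hη]; ring
    have hησ : η < σ := by
      have : 0 < σ - η := by rw [hση]; positivity
      linarith
    have hprofile := hM.ae_eventually_exists_le_distInt (fun _ => σ) hη0 θ (by
      have hmem : ∀ᵐ y ∂(riemannianMeasure d M), y ∈ M := ae_restrict_mem hM.measurableSet
      filter_upwards [hmem] with y hy
      obtain ⟨U, f, hf, u, hu, hfu⟩ := hM y hy
      -- As `d ≥ 1`, the injective derivative moves some coordinate; with equal sides any coordinate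
      -- will do.
      have hne : fderiv ℝ f u (EuclideanSpace.single ⟨0, hd⟩ 1) ≠ 0 := by
        rw [Ne, map_eq_zero_iff _ (hf.injective_fderiv u hu)]
        simp
      obtain ⟨j, hj⟩ : ∃ j, fderiv ℝ f u (EuclideanSpace.single ⟨0, hd⟩ 1) j ≠ 0 := by
        by_contra! h0
        exact hne (PiLp.ext h0)
      exact ⟨j, fun _ => le_rfl, hησ, U, f, hf, u, hu, hfu, _, hj⟩) (by
      filter_upwards [h] with x hx
      have hlt : -((1 + ε / 4) / n) < -((1 + ε / 8) / n) := by
        rw [neg_lt_neg_iff]; gcongr; norm_num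
      have hev := (tendsto_two_pow_atTop.eventually (eventually_const_mul_rpow_le
        (4 * 2 ^ ((1 + ε / 8) / n)) hlt)).and
        ((tendsto_two_pow_atTop.comp (tendsto_add_atTop_nat 1)).eventually
          (hx (ε / 8) (by positivity)))
      filter_upwards [hev] with t ht q hq hqt
      obtain ⟨ht1, ht2⟩ := ht
      obtain ⟨i, hi⟩ := ht2 q hq hqt
      refine ⟨i, le_trans ?_ (hi.trans_eq (by simp))⟩
      rw [two_rpow_neg_natCast_mul, hση, Function.comp_apply, pow_succ,
        Real.mul_rpow (by positivity) (by norm_num), Real.rpow_neg (by norm_num : (0 : ℝ) ≤ 2),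
        ← div_eq_mul_inv, le_div_iff₀ (by positivity)]
      linarith)
    filter_upwards [hprofile] with x hx
    have hlt : -((1 + ε) / n) < -σ := by
      rw [hσ, neg_lt_neg_iff]; gcongr; linarith
    filter_upwards [eventually_exists_two_pow hx, eventually_const_mul_rpow_le (2 ^ σ) hlt,
      eventually_gt_atTop 0] with Q hQ1 hQ2 hQ0 q hq hqQ
    obtain ⟨t, ht, htQ, hQt⟩ := hQ1
    obtain ⟨i, hi⟩ := ht q hq (hqQ.trans htQ)
    refine ⟨i, le_trans ?_ hi⟩
    rw [two_rpow_neg_natCast_mul]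
    calc Q ^ (-((1 + ε) / n)) ≤ 2 ^ (-σ) * Q ^ (-σ) := by
          rw [Real.rpow_neg (by norm_num : (0 : ℝ) ≤ 2), ← div_eq_inv_mul,
            le_div_iff₀ (by positivity), mul_comm]
          exact hQ2
      _ = (2 * Q) ^ (-σ) := (Real.mul_rpow (by norm_num) hQ0.le).symm
      _ ≤ ((2 : ℝ) ^ t) ^ (-σ) := by
          refine Real.rpow_le_rpow_of_nonpos (by positivity) hQt ?_
          have : 0 < σ := by positivity
          linarith
  filter_upwards [ae_all_iff.2 fun k : ℕ => key (1 / (k + 1)) (by positivity)] with x hx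
  refine forall_pos_of_forall_nat (fun ε ε' hεε' h => ?_) hx
  filter_upwards [h, eventually_ge_atTop 1] with Q hQ hQ1 q hq hqQ
  obtain ⟨j, hj⟩ := hQ q hq hqQ
  refine ⟨j, le_trans (Real.rpow_le_rpow_of_exponent_le hQ1 ?_) hj⟩
  rw [neg_le_neg_iff]; gcongr

/-- A point of a box of small volume lies in one of finitely many standard boxes of small
volume. -/
lemma exists_profile {n K t : ℕ} {δ s : ℝ} (hδ : 0 < δ) (hK : s ≤ K * δ)
    (b : Fin n → ℝ) (hb : ∀ i, b i < 1) (hprod : ∏ i, b i < (2 : ℝ) ^ (-(t * s))) :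
    ∃ κ : Fin n → Fin (K + 1), s - n * δ ≤ ∑ i, (κ i : ℝ) * δ ∧
      ∀ i, b i < (2 : ℝ) ^ (-(t * ((κ i : ℝ) * δ))) := by
  have hex (i) : ∃ k : Fin (K + 1), b i < (2 : ℝ) ^ (-(t * ((k : ℝ) * δ))) ∧
      ∀ l : Fin (K + 1), b i < (2 : ℝ) ^ (-(t * ((l : ℝ) * δ))) → l ≤ k := by
    classical
    obtain ⟨k, hk, hmax⟩ := Finset.exists_max_image
      (Finset.univ.filter fun k : Fin (K + 1) => b i < (2 : ℝ) ^ (-(t * ((k : ℝ) * δ)))) id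
      ⟨0, by simpa using hb i⟩
    exact ⟨k, (Finset.mem_filter.1 hk).2, fun l hl => hmax l (by simpa using hl)⟩
  choose κ hκ hmax using hex
  refine ⟨κ, ?_, hκ⟩
  -- Each `κ i` is maximal. If one reaches the cap `K`, it alone gives the sum `s`; otherwise each
  -- `b i` is within one step `δ` of its bound, which costs `n * δ` in total.
  by_cases hfull : ∃ i, (κ i : ℕ) = K
  · obtain ⟨i, hi⟩ := hfull
    have h1 : (κ i : ℝ) * δ ≤ ∑ i, (κ i : ℝ) * δ :=
      Finset.single_le_sum (f := fun i => (κ i : ℝ) * δ) (fun _ _ => by positivity)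
        (Finset.mem_univ i)
    rw [show ((κ i : ℕ) : ℝ) = K by exact_mod_cast hi] at h1
    have : 0 ≤ n * δ := by positivity
    linarith
  push Not at hfull
  have hge (i) : (2 : ℝ) ^ (-(t * (((κ i : ℕ) + 1 : ℝ) * δ))) ≤ b i := by
    by_contra! hlt
    have hi : (κ i : ℕ) + 1 < K + 1 := by
      have := (κ i).2
      have := hfull i
      omega
    have := hmax i ⟨(κ i : ℕ) + 1, hi⟩ (by push_cast; exact hlt)
    rw [Fin.le_def] at this
    simp at this
  have h1 : (2 : ℝ) ^ (∑ i, -(t * (((κ i : ℕ) + 1 : ℝ) * δ))) ≤ ∏ i, b i := by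
    rw [Real.rpow_sum_of_pos (by norm_num)]
    exact Finset.prod_le_prod (fun i _ => by positivity) fun i _ => hge i
  have h2 := (Real.rpow_lt_rpow_left_iff (by norm_num : (1 : ℝ) < 2)).1 (h1.trans_lt hprod)
  have h3 : ∑ i, -(t * (((κ i : ℕ) + 1 : ℝ) * δ)) = -(t * (∑ i, (κ i : ℝ) * δ + n * δ)) := by
    simp only [add_mul, mul_add, Finset.sum_neg_distrib, Finset.sum_add_distrib, Finset.mul_sum]
    simp; ring
  rw [h3, neg_lt_neg_iff] at h2
  have h4 := lt_of_mul_lt_mul_left h2 (Nat.cast_nonneg t)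
  linarith

lemma ae_mulSimUpper {n d : ℕ} (hn : 0 < n) {M : Set (EuclideanSpace ℝ (Fin n))}
    (hM : IsSubmanifold d M)
    (hT : ∀ᵐ y ∂(riemannianMeasure d M), ∀ i : Fin n, ¬ OrthogonalToAxis (tangentPlane d M y) i)
    (h : ∀ᵐ x ∂(riemannianMeasure d M), MulSimUpper x.ofLp 0) (θ : Fin n → ℝ) :
    ∀ᵐ x ∂(riemannianMeasure d M), MulSimUpper x.ofLp θ := by
  have hn' : (0 : ℝ) < n := by exact_mod_cast hn
  have : Nonempty (Fin n) := ⟨⟨0, hn⟩⟩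
  have key (ε : ℝ) (hε : 0 < ε) : ∀ᵐ x ∂(riemannianMeasure d M), ∀ᶠ Q : ℝ in atTop, ∀ q : ℤ,
      q ≠ 0 → |(q : ℝ)| ≤ Q → Q ^ (-(1 + 2 * ε)) ≤ ∏ j, distInt (q * x j + θ j) := by
    -- Rounding to a profile lowers the sum of exponents from `1 + ε` to at least `1 + ε / 2`.
    -- Enlarging the box costs a further `n * η = ε / 8`, leaving `1 + 3 * ε / 8`, still above the
    -- homogeneous `1 + ε / 8`.
    set δ : ℝ := ε / (2 * n) with hδ
    have hδ0 : 0 < δ := by positivity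
    have hnδ : n * δ = ε / 2 := by rw [hδ]; field_simp
    set η : ℝ := ε / (8 * n) with hη
    have hη0 : 0 < η := by positivity
    have hnη : n * η = ε / 8 := by rw [hη]; field_simp
    set K : ℕ := ⌈(1 + ε) / δ⌉₊ with hK
    have hKδ : 1 + ε ≤ K * δ := (div_le_iff₀ hδ0).1 (Nat.le_ceil _)
    have hprofile (κ : Fin n → Fin (K + 1)) : ∀ᵐ x ∂(riemannianMeasure d M),
        1 + ε / 2 ≤ ∑ i, (κ i : ℝ) * δ → ∀ᶠ t : ℕ in atTop, ∀ q : ℤ, q ≠ 0 →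
          |(q : ℝ)| ≤ 2 ^ t → ∃ i, (2 : ℝ) ^ (-(t * ((κ i : ℝ) * δ))) ≤
            distInt (q * x i + θ i) := by
      by_cases hκ : 1 + ε / 2 ≤ ∑ i, (κ i : ℝ) * δ
      swap
      · exact Eventually.of_forall fun x hx => absurd hx hκ
      -- The shortest side depends on the profile, so the tangent condition is needed for every
      -- axis.
      obtain ⟨j, -, hj⟩ := Finset.exists_max_image Finset.univ (fun i => (κ i : ℝ) * δ)
        Finset.univ_nonempty
      have hj' (i) : (κ i : ℝ) * δ ≤ (κ j : ℝ) * δ := hj i (Finset.mem_univ i)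
      have hηj : η < (κ j : ℝ) * δ := by
        have h1 : ∑ i, (κ i : ℝ) * δ ≤ n * ((κ j : ℝ) * δ) := by
          simpa using Finset.sum_le_sum fun i (_ : i ∈ Finset.univ) => hj' i
        have h2 : n * η < n * ((κ j : ℝ) * δ) := by rw [hnη]; linarith
        exact lt_of_mul_lt_mul_left h2 hn'.le
      have hae := hM.ae_eventually_exists_le_distInt (fun i => (κ i : ℝ) * δ) hη0 θ (by
        filter_upwards [hT] with y hy
        have hyj := hy j
        unfold OrthogonalToAxis at hyj
        push Not at hyj
        obtain ⟨w, ⟨U, f, hf, u, hu, hfu, v, rfl⟩, hw⟩ := hyj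
        refine ⟨j, hj', hηj, U, f, hf, u, hu, hfu, v, ?_⟩
        simpa [EuclideanSpace.inner_single_right] using hw) (by
        filter_upwards [h] with x hx
        have hlt : -(1 + 3 * ε / 8) < -(1 + ε / 8) := by linarith
        have hev := (tendsto_two_pow_atTop.eventually (eventually_const_mul_rpow_lt
          (4 ^ n * 2 ^ (1 + ε / 8)) hlt)).and
          ((tendsto_two_pow_atTop.comp (tendsto_add_atTop_nat 1)).eventually
            (hx (ε / 8) (by positivity)))
        filter_upwards [hev] with t ht q hq hqt
        obtain ⟨ht1, ht2⟩ := ht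
        have h1 := ht2 q hq hqt
        simp only [Pi.zero_apply, add_zero, Function.comp_apply] at h1
        by_contra! hcon
        have h2 : ∏ i, distInt (q * x i) ≤
            4 ^ n * ((2 : ℝ) ^ t) ^ (-(∑ i, (κ i : ℝ) * δ - n * η)) := by
          calc ∏ i, distInt (q * x i) ≤
                ∏ i, 4 * ((2 : ℝ) ^ t) ^ (-((κ i : ℝ) * δ - η)) :=
                Finset.prod_le_prod (fun i _ => distInt_nonneg _) fun i _ => by
                  rw [← two_rpow_neg_natCast_mul]; exact (hcon i).le
            _ = _ := by
                rw [Finset.prod_mul_distrib, ← Real.rpow_sum_of_pos (by positivity)]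
                simp
        have h3 : ((2 : ℝ) ^ t) ^ (-(∑ i, (κ i : ℝ) * δ - n * η)) ≤
            ((2 : ℝ) ^ t) ^ (-(1 + 3 * ε / 8)) :=
          Real.rpow_le_rpow_of_exponent_le (one_le_pow₀ (by norm_num)) (by rw [hnη]; linarith)
        have h4 : ((2 : ℝ) ^ t) ^ (-(1 + ε / 8)) / 2 ^ (1 + ε / 8) ≤
            4 ^ n * ((2 : ℝ) ^ t) ^ (-(1 + 3 * ε / 8)) := by
          rw [div_eq_mul_inv, ← Real.rpow_neg (by norm_num),
            ← Real.mul_rpow (by positivity) (by norm_num), ← pow_succ]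
          exact h1.trans (h2.trans (by gcongr))
        rw [div_le_iff₀ (by positivity)] at h4
        linarith)
      filter_upwards [hae] with x hx _ using hx
    filter_upwards [ae_all_iff.2 hprofile] with x hx
    have hall : ∀ᶠ t : ℕ in atTop, ∀ κ : Fin n → Fin (K + 1), 1 + ε / 2 ≤ ∑ i, (κ i : ℝ) * δ →
        ∀ q : ℤ, q ≠ 0 → |(q : ℝ)| ≤ 2 ^ t → ∃ i, (2 : ℝ) ^ (-(t * ((κ i : ℝ) * δ))) ≤
          distInt (q * x i + θ i) := by
      rw [eventually_all]
      intro κ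
      by_cases hκ : 1 + ε / 2 ≤ ∑ i, (κ i : ℝ) * δ
      · exact (hx κ hκ).mono fun t ht _ => ht
      · exact Eventually.of_forall fun t ht => absurd ht hκ
    have hlt : -(1 + 2 * ε) < -(1 + ε) := by linarith
    filter_upwards [eventually_exists_two_pow hall,
      eventually_const_mul_rpow_le (2 ^ (1 + ε)) hlt, eventually_gt_atTop 0] with
      Q hQ1 hQ2 hQ0 q hq hqQ
    obtain ⟨t, ht, htQ, hQt⟩ := hQ1
    have hmain : (2 : ℝ) ^ (-(t * (1 + ε))) ≤ ∏ j, distInt (q * x j + θ j) := by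
      by_contra! hcon
      obtain ⟨κ, hκ1, hκ2⟩ := exists_profile hδ0 hKδ _
        (fun i => (distInt_le_half (q * x i + θ i)).trans_lt (by norm_num)) hcon
      obtain ⟨i, hi⟩ := ht κ (by linarith) q hq (hqQ.trans htQ)
      exact absurd (hκ2 i) (not_lt.2 hi)
    refine le_trans ?_ hmain
    rw [two_rpow_neg_natCast_mul]
    calc Q ^ (-(1 + 2 * ε)) ≤ 2 ^ (-(1 + ε)) * Q ^ (-(1 + ε)) := by
          rw [Real.rpow_neg (by norm_num : (0 : ℝ) ≤ 2), ← div_eq_inv_mul,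
            le_div_iff₀ (by positivity), mul_comm]
          exact hQ2
      _ = (2 * Q) ^ (-(1 + ε)) := (Real.mul_rpow (by norm_num) hQ0.le).symm
      _ ≤ ((2 : ℝ) ^ t) ^ (-(1 + ε)) :=
          Real.rpow_le_rpow_of_nonpos (by positivity) hQt (by linarith)
  filter_upwards [ae_all_iff.2 fun k : ℕ => key (1 / (k + 1) / 2) (by positivity)] with x hx
  refine forall_pos_of_forall_nat (fun ε ε' hεε' h => ?_) fun k => ?_
  · filter_upwards [h, eventually_ge_atTop 1] with Q hQ hQ1 q hq hqQ
    exact le_trans (Real.rpow_le_rpow_of_exponent_le hQ1 (by linarith)) (hQ q hq hqQ)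
  · have := hx k
    rwa [mul_div_cancel₀ _ (two_ne_zero' ℝ)] at this

/-! ### Equality of the exponents with one -/

lemma one_le_exponent_col_zero {n : ℕ} (hn : 0 < n) (x : EuclideanSpace ℝ (Fin n)) :
    1 ≤ exponent (col x) 0 :=
  one_le_exponent_col_of_int hn x 0 fun j => by simp [distInt]

lemma exponent_col_eq_one_iff_row {n : ℕ} (hn : 0 < n) (x : EuclideanSpace ℝ (Fin n)) :
    exponent (col x) 0 = 1 ↔ exponent (row x) 0 = 1 := by
  rw [(one_le_exponent_col_zero hn x).ge_iff_eq'.symm, (one_le_exponent_row hn x).ge_iff_eq'.symm]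
  exact exponent_col_le_one_iff_row hn x

lemma mulExponent_col_eq_one_iff_row {n : ℕ} (hn : 0 < n) (x : EuclideanSpace ℝ (Fin n)) :
    mulExponent (col x) 0 = 1 ↔ mulExponent (row x) 0 = 1 := by
  have h1 := (one_le_exponent_col_zero hn x).trans (exponent_le_mulExponent _ _)
  have h2 := (one_le_exponent_row hn x).trans (exponent_le_mulExponent _ _)
  rw [h1.ge_iff_eq'.symm, h2.ge_iff_eq'.symm]
  exact mulExponent_col_le_one_iff_row hn x

lemma simExtremal_iff_dualExtremal {n : ℕ} (hn : 0 < n) (μ : Measure (EuclideanSpace ℝ (Fin n))) :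
    SimExtremal μ ↔ DualExtremal μ :=
  eventually_congr (Eventually.of_forall fun x => exponent_col_eq_one_iff_row hn x)

lemma simStronglyExtremal_iff_dualStronglyExtremal {n : ℕ} (hn : 0 < n)
    (μ : Measure (EuclideanSpace ℝ (Fin n))) :
    SimStronglyExtremal μ ↔ DualStronglyExtremal μ :=
  eventually_congr (Eventually.of_forall fun x => mulExponent_col_eq_one_iff_row hn x)

lemma simExtremal_iff_simInhomExtremal {n d : ℕ} (hd : 1 ≤ d) (hn : 0 < n)
    {M : Set (EuclideanSpace ℝ (Fin n))} (hM : IsSubmanifold d M) :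
    SimExtremal (riemannianMeasure d M) ↔ SimInhomExtremal (riemannianMeasure d M) := by
  refine ⟨fun h θ => ?_, fun h => h 0⟩
  have hupper : ∀ᵐ x ∂(riemannianMeasure d M), SimUpper x.ofLp 0 :=
    h.mono fun x hx => (exponent_col_le_one_iff hn x 0).1 hx.le
  filter_upwards [hupper, ae_simUpper hd hn hM hupper θ] with x hx hxθ
  exact le_antisymm ((exponent_col_le_one_iff hn x θ).2 hxθ) (hx.one_le_exponent_col hn θ)

lemma simStronglyExtremal_iff_simInhomStronglyExtremal {n d : ℕ} (hn : 0 < n)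
    {M : Set (EuclideanSpace ℝ (Fin n))} (hM : IsSubmanifold d M)
    (hT : ∀ᵐ y ∂(riemannianMeasure d M), ∀ i : Fin n,
      ¬ OrthogonalToAxis (tangentPlane d M y) i) :
    SimStronglyExtremal (riemannianMeasure d M) ↔
      SimInhomStronglyExtremal (riemannianMeasure d M) := by
  refine ⟨fun h θ => ?_, fun h => h 0⟩
  have hupper : ∀ᵐ x ∂(riemannianMeasure d M), MulSimUpper x.ofLp 0 :=
    h.mono fun x hx => (mulExponent_col_le_one_iff x 0).1 hx.le
  filter_upwards [h, ae_mulSimUpper hn hM hT hupper θ] with x hx hxθ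
  refine le_antisymm ((mulExponent_col_le_one_iff x θ).2 hxθ)
    (le_trans ?_ (exponent_le_mulExponent _ _))
  -- The lower bound comes from the ordinary exponent, because `w(x, 0) ≤ w^×(x, 0) = 1`.
  exact ((exponent_col_le_one_iff hn x 0).1
    ((exponent_le_mulExponent _ _).trans hx.le)).one_le_exponent_col hn θ

/-- For `n = 0` no derivative from a space of positive dimension is injective; this degenerate case
is settled separately. -/
lemma IsSubmanifold.eq_empty {d : ℕ} (hd : 1 ≤ d) {M : Set (EuclideanSpace ℝ (Fin 0))}
    (hM : IsSubmanifold d M) : M = ∅ := by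
  refine Set.eq_empty_of_forall_notMem fun y hy => ?_
  obtain ⟨U, f, hf, u, hu, -⟩ := hM y hy
  have h0 : EuclideanSpace.single (⟨0, hd⟩ : Fin d) (1 : ℝ) = 0 :=
    hf.injective_fderiv u hu (Subsingleton.elim _ _)
  simp at h0

end DiophantineSubmanifold

theorem theorem4 {n d : ℕ} (hd : 1 ≤ d) (M : Set (EuclideanSpace ℝ (Fin n)))
    (hM : DiophantineSubmanifold.IsSubmanifold d M) :
    -- (A), with the homogeneous notion on the left read in either of its two forms
    ((DiophantineSubmanifold.SimExtremal (DiophantineSubmanifold.riemannianMeasure d M) ↔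
        DiophantineSubmanifold.SimInhomExtremal (DiophantineSubmanifold.riemannianMeasure d M)) ∧
      (DiophantineSubmanifold.DualExtremal (DiophantineSubmanifold.riemannianMeasure d M) ↔
        DiophantineSubmanifold.SimInhomExtremal
          (DiophantineSubmanifold.riemannianMeasure d M))) ∧
    -- (B), likewise
    ((∀ᵐ y ∂(DiophantineSubmanifold.riemannianMeasure d M), ∀ i : Fin n,
        ¬ DiophantineSubmanifold.OrthogonalToAxis
          (DiophantineSubmanifold.tangentPlane d M y) i) →
      (DiophantineSubmanifold.SimStronglyExtremal
          (DiophantineSubmanifold.riemannianMeasure d M) ↔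
        DiophantineSubmanifold.SimInhomStronglyExtremal
          (DiophantineSubmanifold.riemannianMeasure d M)) ∧
      (DiophantineSubmanifold.DualStronglyExtremal
          (DiophantineSubmanifold.riemannianMeasure d M) ↔
        DiophantineSubmanifold.SimInhomStronglyExtremal
          (DiophantineSubmanifold.riemannianMeasure d M))) := by
  open DiophantineSubmanifold in
  obtain rfl | hn := Nat.eq_zero_or_pos n
  · have hμ : riemannianMeasure d M = 0 := by
      rw [hM.eq_empty hd, riemannianMeasure, Measure.restrict_empty]
    simp [hμ, SimExtremal, DualExtremal, SimInhomExtremal, SimStronglyExtremal,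
      DualStronglyExtremal, SimInhomStronglyExtremal]
  · have hA := simExtremal_iff_simInhomExtremal hd hn hM
    refine ⟨⟨hA, (simExtremal_iff_dualExtremal hn _).symm.trans hA⟩, fun hT => ?_⟩
    have hB := simStronglyExtremal_iff_simInhomStronglyExtremal hn hM hT
    exact ⟨hB, (simStronglyExtremal_iff_dualStronglyExtremal hn _).symm.trans hB⟩
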